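/- Let $n\ge 3$, $m\ge 0$, and write $x=(x_1,x')\in\mathbb R\times\mathbb R^{n-1}$, with Cartesian components of tensors indexed by $1,\dots,n$. Let $f(x_1,x')$ be a complex symmetric $m$-tensor field on $\mathbb R^n$, supported in the variable $x'$ in a compact set $K\subset\mathbb R^{n-1}$ (that is, $f(x_1,x')=0$ for all $x_1$ and all $x'\notin K$), with $f(0,\cdot)$ integrable. For a centre $x_0\in\mathbb R^{n-1}$ use polar coordinates $x'=x_0+r\theta$, $r>0$, $\theta\in\mathbb S^{n-2}$, and put $e_r=(0,\theta)$, $e_1=(1,0,\dots,0)$. Assume that for every centre $x_0\notin K$, every $0\le\alpha\le m$ and a.e. $\theta\in\mathbb S^{n-2}$, $$\int_0^\infty r^\alpha \sum_{i_1,\dots,i_m=1}^n f_{i_1\cdots i_m}(0,x_0+r\theta)\prod_{j=1}^m (e_1+\mathrm i\,e_r)_{i_j}\,dr=0 .$$ For a symmetric tensor $t$ of order $q$ let $(i_\delta t)_{i_1\cdots i_{q+2}}$ be the average of $t_{i_1\cdots i_q}\delta_{i_{q+1}i_{q+2}}$ over all permutations of the indices $i_1,\dots,i_{q+2}$. Then: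 1. If $m\in\{0,1\}$, then $f(0,x')=0$ for a.e. $x'$, and at every point $x'$ at which $f(0,\cdot)$ is continuous. 2. If $m\ge 2$, there is a symmetric $(m-2)$-tensor field $v$ on $\mathbb R^n$, supported in $K$ in the variable $x'$ and with $v(0,\cdot)$ integrable, such that $f(0,x')=i_\delta v(0,x')$ for a.e. $x'$, and at every point $x'$ at which $f(0,\cdot)$ is continuous. Moreover $v$ can be chosen so that, at every point $(x_1,x')$, for $0\le p\le m-2$ and $2\le i_1,\dots,i_p\le n$, $$v_{i_1\cdots i_p1\cdots1}=\binom{m-2}{m-p-2}^{-1}\Big(\sum_{l=1}^{[\frac{p+2}2]}(-1)^{l-1}\,i_\delta^{\,l-1}\tilde f^{\,p+2-2l}\Big)_{i_1\cdots i_p},$$ where $\tilde f^{\,q}_{i_1\cdots i_q}=\binom mq f_{i_1\cdots i_q1\cdots1}$ ($2\le i_1,\dots,i_q\le n$) is regarded as a symmetric $q$-tensor on $\mathbb R^{n-1}$, and $i_\delta$ in this formula acts on tensors on $\mathbb R^{n-1}$. -/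

import Mathlib

open MeasureTheory

/-- Complex tensors of order `m`, given by their Cartesian components; `ι` is the range of each
index. -/
abbrev Tensor (ι : Type) (m : ℕ) : Type := (Fin m → ι) → ℂ

/-- The tensor `t` is symmetric in its indices. -/
def Tensor.IsSymmetric {ι : Type} {m : ℕ} (t : Tensor ι m) : Prop :=
  ∀ (π : Equiv.Perm (Fin m)) (i : Fin m → ι), t (i ∘ π) = t i

/-- `(i_δ t)_{i₁⋯i_{m+2}} = σ(i₁⋯i_{m+2}) t_{i₁⋯i_m} δ_{i_{m+1} i_{m+2}}`, where `σ` is the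
average over all permutations of the indices. -/
noncomputable def Tensor.iDelta {ι : Type} [DecidableEq ι] {m : ℕ} (t : Tensor ι m) :
    Tensor ι (m + 2) := fun i =>
  ((m + 2).factorial : ℂ)⁻¹ * ∑ π : Equiv.Perm (Fin (m + 2)),
    t (fun j => i (π (Fin.castAdd 2 j))) *
      (if i (π (Fin.natAdd m 0)) = i (π (Fin.natAdd m 1)) then 1 else 0)

/-- The `l`-fold composition of `i_δ` with itself. -/
noncomputable def Tensor.iDeltaPow {ι : Type} [DecidableEq ι] {m : ℕ} (t : Tensor ι m) :
    (l : ℕ) → Tensor ι (m + 2 * l)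
  | 0 => t
  | l + 1 => (Tensor.iDeltaPow t l).iDelta

/-- The full contraction `∑ t_{i₁⋯i_m} ζ_{i₁} ⋯ ζ_{i_m}`. -/
noncomputable def Tensor.contract {ι : Type} [Fintype ι] {m : ℕ} (t : Tensor ι m) (ζ : ι → ℂ) :
    ℂ :=
  ∑ i : Fin m → ι, t i * ∏ j, ζ (i j)

/-- The multi-index `(i₁, …, i_p, 1, …, 1)` of length `m`. The coordinates of `ℝ × ℝ^d` are
numbered by `Fin (d + 1)`: the first coordinate `x₁` has number `0`, and the `k`-th coordinate
of `x' ∈ ℝ^d` has number `k.succ`. -/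
def padIndex {d p : ℕ} (m : ℕ) (i : Fin p → Fin d) : Fin m → Fin (d + 1) := fun j =>
  if h : (j : ℕ) < p then (i ⟨j, h⟩).succ else 0

/-- `f̃^q = binom(m, q) f_{i₁⋯i_q 1⋯1}`, a tensor of order `q` on `ℝ^d`. -/
noncomputable def Tensor.tilde {d m : ℕ} (f : Tensor (Fin (d + 1)) m) (q : ℕ) :
    Tensor (Fin d) q := fun i =>
  (m.choose q : ℂ) * f (padIndex m i)

/-- The vector `e₁ + i e_r` of `ℂ^{d+1}` in the direction `e_r = θ ∈ ℝ^d`. -/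
noncomputable def complexDirection {d : ℕ} (θ : EuclideanSpace ℝ (Fin d)) : Fin (d + 1) → ℂ :=
  Fin.cons 1 (fun j => Complex.I * (θ j : ℂ))

/-- `f(x₁, x')` is a symmetric `m`-tensor field on `ℝ × ℝ^d`, supported in `K` in the variable
`x'`, whose slice `x₁ = 0` is integrable. -/
structure IsTensorField {d m : ℕ} (K : Set (EuclideanSpace ℝ (Fin d)))
    (f : ℝ → EuclideanSpace ℝ (Fin d) → Tensor (Fin (d + 1)) m) : Prop where
  symmetric : ∀ x₁ x', (f x₁ x').IsSymmetric
  support : ∀ x₁ x', x' ∉ K → f x₁ x' = 0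
  integrable : Integrable (f 0) volume

/-- The sum `∑_{l=1}^{[(p+2)/2]} (-1)^{l-1} i_δ^{l-1} f̃^{p+2-2l}`, a tensor of order `p` on
`ℝ^d`; the summation variable is `j = l - 1`, which runs over `0 ≤ j ≤ [p/2]`. -/
noncomputable def Tensor.alternatingSum {d m : ℕ} (f : Tensor (Fin (d + 1)) m) (p : ℕ) :
    Tensor (Fin d) p := fun i =>
  ∑ j : Fin (p / 2 + 1), (-1 : ℂ) ^ (j : ℕ) *
    (f.tilde (p - 2 * (j : ℕ))).iDeltaPow (j : ℕ) (i ∘ Fin.cast (by omega))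

/-- The moment of order `α` of `f(0, ·)` contracted with `(e₁ + i e_r)^{⊗ m}`, along the ray
`x' = x₀ + r θ`, in polar coordinates `(r, θ)` of `ℝ^d` centred at `x₀`. -/
noncomputable def rayMoment {d m : ℕ}
    (f : ℝ → EuclideanSpace ℝ (Fin d) → Tensor (Fin (d + 1)) m)
    (x₀ : EuclideanSpace ℝ (Fin d)) (α : ℕ) (θ : EuclideanSpace ℝ (Fin d)) : ℂ :=
  ∫ r in Set.Ioi (0 : ℝ), (r : ℂ) ^ α * (f 0 (x₀ + r • θ)).contract (complexDirection θ)

/-! For a fixed unit vector θ let F_θ be the contraction of f(0, ·) with (e₁ + iθ)^{⊗m}. The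
analytic half shows F_θ = 0 almost everywhere. Fubini turns the hypothesis into: for a.e. θ, the
moments of F_θ up to order m vanish along rays in direction θ from a.e. centre outside K.
Integrating them over a slab of centres, against a Taylor polynomial of the exponential, bounds the
Fourier transform of F_θ at ξ by c(ξ)|⟨ξ, θ⟩|^{m+1}, with c(ξ) independent of θ
(`norm_integral_exp_mul_le`). For fixed ξ this transform is T(ξ) contracted with (e₁ + iθ)^{⊗m}; on
a great circle through ξ/|ξ| it is a trigonometric polynomial of degree at most m. It vanishes to
order m + 1 at two opposite points, hence identically (`Tensor.contract_complexDirection_eq_zero`).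
Injectivity of the Fourier transform on L¹ gives F_θ = 0.

The algebraic half is pointwise. A symmetric tensor is a homogeneous polynomial, and `iDelta` is
multiplication by x₀² + |x|². Division by this quadric has the alternating sums A_p as quotient
coefficients and x₀A_{k+1} + A_{k+2} as remainder (`Tensor.sum_tilde_eq`). Vanishing on all e₁ + iθ
means vanishing at x₀ = ±i|x|, which kills the remainder. -/

/-! ### Symmetric tensors as homogeneous polynomials -/

theorem exists_perm_of_map_univ_eq {ι : Type} [LinearOrder ι] {m : ℕ} {i j : Fin m → ι}
    (h : Finset.univ.val.map i = Finset.univ.val.map j) :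
    ∃ π : Equiv.Perm (Fin m), i ∘ π = j := by
  rw [Fin.univ_val_map, Fin.univ_val_map, Multiset.coe_eq_coe] at h
  have hs : i ∘ Tuple.sort i = j ∘ Tuple.sort j := by
    apply List.ofFn_injective
    refine List.Perm.eq_of_pairwise' (r := (· ≤ ·))
      (Tuple.monotone_sort i).sortedLE_ofFn.pairwise (Tuple.monotone_sort j).sortedLE_ofFn.pairwise ?_
    exact ((Tuple.sort i).ofFn_comp_perm i).trans
      (h.trans ((Tuple.sort j).ofFn_comp_perm j).symm)
  refine ⟨(Tuple.sort j).symm.trans (Tuple.sort i), ?_⟩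
  funext a
  have := congrFun hs ((Tuple.sort j).symm a)
  simpa using this

namespace Tensor

theorem IsSymmetric.eq_of_map_univ_eq {ι : Type} [LinearOrder ι] {m : ℕ} {t : Tensor ι m}
    (ht : t.IsSymmetric) {i j : Fin m → ι}
    (h : Finset.univ.val.map i = Finset.univ.val.map j) : t i = t j := by
  obtain ⟨π, rfl⟩ := exists_perm_of_map_univ_eq h
  exact (ht π i).symm

/-- A symmetric tensor is determined by the polynomial function it defines, even on the
vectors with positive coordinates. -/
theorem IsSymmetric.eq_zero_of_contract {ι : Type} [LinearOrder ι] [Fintype ι] {m : ℕ}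
    {t : Tensor ι m} (ht : t.IsSymmetric)
    (h : ∀ x : ι → ℝ, (∀ a, 0 < x a) → t.contract (fun a => (x a : ℂ)) = 0) : t = 0 := by
  let P : MvPolynomial ι ℂ := ∑ i : Fin m → ι, MvPolynomial.C (t i) * ∏ j, MvPolynomial.X (i j)
  have hP : P = 0 := by
    refine MvPolynomial.funext_set (fun _ => (fun r : ℝ => (r : ℂ)) '' Set.Ioi 0)
      (fun _ => (Set.Ioi_infinite 0).image (Complex.ofReal_injective.injOn)) ?_
    intro z hz
    choose x hx hxz using fun a => hz a (Set.mem_univ a)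
    have : z = fun a => (x a : ℂ) := funext fun a => (hxz a).symm
    rw [map_zero, ← h x hx, this]
    simp [P, contract, map_sum, map_prod]
  funext i₀
  have hmon : ∀ i : Fin m → ι, (∏ j, MvPolynomial.X (i j) : MvPolynomial ι ℂ) =
      MvPolynomial.monomial (∑ j, Finsupp.single (i j) 1) 1 := by
    intro i
    rw [MvPolynomial.monomial_sum_one]
    rfl
  have hms : ∀ i : Fin m → ι, Finsupp.toMultiset (∑ j, Finsupp.single (i j) 1) =
      Finset.univ.val.map i := by
    intro i
    rw [map_sum, Finset.sum_congr rfl fun j _ => (Finsupp.toMultiset_single (i j) 1).trans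
      (one_nsmul _)]
    exact (Multiset.bind_singleton Finset.univ.val i)
  have hc := congrArg (MvPolynomial.coeff (∑ j, Finsupp.single (i₀ j) 1)) hP
  simp only [P, MvPolynomial.coeff_sum, hmon, MvPolynomial.coeff_C_mul,
    MvPolynomial.coeff_monomial, MvPolynomial.coeff_zero, mul_ite, mul_one, mul_zero] at hc
  -- By symmetry, the coefficient of P at the monomial of i₀ is t i₀ times the number of
  -- rearrangements of i₀, which is not zero.
  rw [← Finset.sum_filter, Finset.sum_congr rfl (g := fun _ => t i₀), Finset.sum_const,
    nsmul_eq_mul, mul_eq_zero] at hc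
  · refine hc.resolve_left ?_
    rw [Nat.cast_eq_zero]
    exact Finset.card_ne_zero_of_mem (a := i₀) (by simp)
  · intro i hi
    refine ht.eq_of_map_univ_eq ?_
    rw [← hms, ← hms, (Finset.mem_filter.1 hi).2]

theorem contract_smul_vec {ι : Type} [Fintype ι] {m : ℕ} (t : Tensor ι m) (c : ℂ) (ζ : ι → ℂ) :
    t.contract (fun a => c * ζ a) = c ^ m * t.contract ζ := by
  simp only [contract, Finset.prod_mul_distrib, Finset.prod_const, Finset.card_univ,
    Fintype.card_fin, Finset.mul_sum]
  exact Finset.sum_congr rfl fun i _ => by ring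

theorem contract_const_mul {ι : Type} [Fintype ι] {m : ℕ} (t : Tensor ι m) (c : ℂ) (ζ : ι → ℂ) :
    contract (fun i => c * t i) ζ = c * t.contract ζ := by
  simp only [contract, Finset.mul_sum, mul_assoc]

theorem contract_sub {ι : Type} [Fintype ι] {m : ℕ} (s t : Tensor ι m) (ζ : ι → ℂ) :
    contract (fun i => s i - t i) ζ = s.contract ζ - t.contract ζ := by
  simp only [contract, ← Finset.sum_sub_distrib, sub_mul]

theorem contract_cast {ι : Type} [Fintype ι] {m n : ℕ} (h : m = n) (t : Tensor ι n)
    (ζ : ι → ℂ) : contract (fun i : Fin m → ι => t (i ∘ Fin.cast h.symm)) ζ = t.contract ζ := by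
  subst h
  rfl

theorem contract_succ {ι : Type} [Fintype ι] {m : ℕ} (t : Tensor ι (m + 1)) (ζ : ι → ℂ) :
    t.contract ζ = ∑ a, ζ a * contract (fun i => t (Fin.cons a i)) ζ := by
  rw [contract, ← (Fin.consEquiv fun _ => ι).sum_comp, Fintype.sum_prod_type]
  refine Finset.sum_congr rfl fun a _ => ?_
  rw [contract, Finset.mul_sum]
  refine Finset.sum_congr rfl fun i _ => ?_
  simp [Fin.consEquiv, Fin.prod_univ_succ]
  ring

/-- The product of the ζ's is invariant under relabelling of the slots, so every permutation in the
average contributes the same term. -/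
theorem contract_iDelta {ι : Type} [Fintype ι] [DecidableEq ι] {m : ℕ} (t : Tensor ι m)
    (ζ : ι → ℂ) : t.iDelta.contract ζ = t.contract ζ * ∑ a, ζ a ^ 2 := by
  have key : ∀ π : Equiv.Perm (Fin (m + 2)),
      ∑ i : Fin (m + 2) → ι, (t (fun j => i (π (Fin.castAdd 2 j))) *
        (if i (π (Fin.natAdd m 0)) = i (π (Fin.natAdd m 1)) then 1 else 0)) * ∏ j, ζ (i j) =
      t.contract ζ * ∑ a, ζ a ^ 2 := by
    intro π
    rw [← (Equiv.arrowCongr π (Equiv.refl ι)).sum_comp, ← (Fin.appendEquiv m 2).sum_comp,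
      Fintype.sum_prod_type, contract, Finset.sum_mul]
    refine Finset.sum_congr rfl fun i _ => ?_
    rw [← (finTwoArrowEquiv ι).symm.sum_comp, Fintype.sum_prod_type, Finset.mul_sum]
    refine Finset.sum_congr rfl fun a _ => ?_
    have hprod : ∀ b, ∏ j, ζ ((Equiv.arrowCongr π (Equiv.refl ι))
        (Fin.appendEquiv m 2 (i, (finTwoArrowEquiv ι).symm (a, b))) j) =
        (∏ j, ζ (i j)) * (ζ a * ζ b) := by
      intro b
      rw [← Equiv.prod_comp π]
      simp [Equiv.arrowCongr, Fin.appendEquiv, Fin.prod_univ_add]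
    simp only [hprod]
    rw [Finset.sum_eq_single a]
    · simp [Equiv.arrowCongr, Fin.appendEquiv]
      ring
    · intro b _ hb
      simp [Equiv.arrowCongr, Fin.appendEquiv, hb.symm]
    · simp
  have hfac : ((m + 2).factorial : ℂ) ≠ 0 := by exact_mod_cast Nat.factorial_ne_zero _
  unfold iDelta
  rw [contract_const_mul, contract]
  simp only [Finset.sum_mul]
  rw [Finset.sum_comm, Finset.sum_congr rfl fun π _ => key π]
  simp [Fintype.card_perm]
  field_simp

theorem contract_iDeltaPow {ι : Type} [Fintype ι] [DecidableEq ι] {m : ℕ} (t : Tensor ι m)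
    (l : ℕ) (ζ : ι → ℂ) :
    (t.iDeltaPow l).contract ζ = t.contract ζ * (∑ a, ζ a ^ 2) ^ l := by
  induction l with
  | zero => simp [iDeltaPow]
  | succ l ih =>
    rw [pow_succ, ← mul_assoc, ← ih]
    exact contract_iDelta _ _

theorem iDelta_isSymmetric {ι : Type} [DecidableEq ι] {m : ℕ} (t : Tensor ι m) :
    t.iDelta.IsSymmetric := by
  intro σ i
  unfold iDelta
  congr 1
  exact Equiv.sum_comp (Equiv.mulLeft σ) (fun π : Equiv.Perm (Fin (m + 2)) => t (fun j => i (π (Fin.castAdd 2 j))) *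
    (if i (π (Fin.natAdd m 0)) = i (π (Fin.natAdd m 1)) then 1 else 0))

theorem IsSymmetric.iDeltaPow {ι : Type} [DecidableEq ι] {m : ℕ} {t : Tensor ι m}
    (ht : t.IsSymmetric) (l : ℕ) : (t.iDeltaPow l).IsSymmetric := by
  cases l with
  | zero => exact ht
  | succ l => exact iDelta_isSymmetric _

theorem IsSymmetric.comp_cast {ι : Type} {m n : ℕ} (h : m = n) {t : Tensor ι n}
    (ht : t.IsSymmetric) :
    IsSymmetric (fun i : Fin m → ι => t (i ∘ Fin.cast h.symm)) := by
  subst h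
  exact ht

end Tensor

/-! ### Expansion in powers of the first coordinate -/

theorem map_univ_padIndex {d p m : ℕ} (h : p ≤ m) (i : Fin p → Fin d) :
    Finset.univ.val.map (padIndex m i) =
      (Finset.univ.val.map i).map Fin.succ + Multiset.replicate (m - p) 0 := by
  obtain ⟨c, rfl⟩ := Nat.exists_eq_add_of_le h
  have : padIndex (p + c) i = Fin.append (Fin.succ ∘ i) (fun _ => 0) := by
    funext j
    refine Fin.addCases (fun j => ?_) (fun j => ?_) j <;> simp [padIndex]
  rw [this, Fin.univ_val_map, List.ofFn_fin_append, Fin.univ_val_map]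
  simp [List.ofFn_const, ← Multiset.coe_add, List.map_ofFn, Multiset.coe_replicate]

theorem padIndex_cons {d p m : ℕ} (a : Fin d) (i : Fin p → Fin d) :
    padIndex (m + 1) (Fin.cons a i : Fin (p + 1) → Fin d) = Fin.cons a.succ (padIndex m i) := by
  funext j
  refine Fin.cases ?_ (fun j => ?_) j
  · simp [padIndex]
  · by_cases h : (j : ℕ) < p
    · simp only [padIndex, Fin.val_succ, Nat.add_lt_add_iff_right, h, dite_true, Fin.cons_succ]
      rfl
    · simp [padIndex, h]

namespace Tensor

theorem IsSymmetric.tilde {d m : ℕ} {T : Tensor (Fin (d + 1)) m} (hT : T.IsSymmetric) (q : ℕ) :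
    (T.tilde q).IsSymmetric := by
  intro π i
  unfold Tensor.tilde
  by_cases h : q ≤ m
  · congr 1
    refine hT.eq_of_map_univ_eq ?_
    rw [map_univ_padIndex h, map_univ_padIndex h, ← Multiset.map_map, Multiset.map_univ_val_equiv]
  -- For q > m the padded index is a truncation and its value need not be symmetric, but the
  -- binomial coefficient is zero.
  · simp [Nat.choose_eq_zero_of_lt (not_le.1 h)]

theorem IsSymmetric.alternatingSum {d m : ℕ} {T : Tensor (Fin (d + 1)) m} (hT : T.IsSymmetric)
    (p : ℕ) : (T.alternatingSum p).IsSymmetric := by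
  intro π i
  unfold Tensor.alternatingSum
  refine Finset.sum_congr rfl fun j _ => ?_
  congr 1
  exact IsSymmetric.comp_cast (by omega) ((hT.tilde _).iDeltaPow j) π i

/-- Expansion of the polynomial of a symmetric tensor on `ℝ × ℝ^d` in powers of the first
coordinate. -/
theorem IsSymmetric.contract_cons {d m : ℕ} {T : Tensor (Fin (d + 1)) m} (hT : T.IsSymmetric)
    (x₀ : ℂ) (x : Fin d → ℂ) :
    T.contract (Fin.cons x₀ x) =
      ∑ q ∈ Finset.range (m + 1), x₀ ^ (m - q) * (T.tilde q).contract x := by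
  suffices H : T.contract (Fin.cons x₀ x) = ∑ q ∈ Finset.range (m + 1),
      x₀ ^ (m - q) * ((m.choose q : ℂ) * contract (fun i : Fin q → Fin d => T (padIndex m i)) x) by
    rw [H]
    refine Finset.sum_congr rfl fun q _ => ?_
    unfold Tensor.tilde
    rw [contract_const_mul]
  induction m with
  | zero =>
    simp [contract, Subsingleton.elim (padIndex 0 _) (default : Fin 0 → Fin (d + 1))]
    exact congrArg T (Subsingleton.elim _ _)
  | succ m ih =>
    have hsub : ∀ a, IsSymmetric (fun i => T (Fin.cons a i)) := by
      intro a π i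
      refine hT.eq_of_map_univ_eq ?_
      have : ∀ i : Fin m → Fin (d + 1), Finset.univ.val.map (Fin.cons a i : Fin (m + 1) → _) =
          a ::ₘ Finset.univ.val.map i := by
        intro i
        simp [Fin.univ_val_map, List.ofFn_succ]
      rw [this, this, ← Multiset.map_map, Multiset.map_univ_val_equiv]
    have h0 : ∀ q ≤ m, contract (fun i : Fin q → Fin d => T (Fin.cons 0 (padIndex m i))) x =
        contract (fun i : Fin q → Fin d => T (padIndex (m + 1) i)) x := by
      intro q hq
      congr 1
      funext i
      refine hT.eq_of_map_univ_eq ?_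
      rw [map_univ_padIndex (by omega), Nat.succ_sub hq, Multiset.replicate_succ,
        Multiset.add_cons, ← map_univ_padIndex hq]
      simp [Fin.univ_val_map, List.ofFn_succ]
    have h1 : ∀ q, ∑ a, x a * contract (fun i : Fin q → Fin d => T (Fin.cons a.succ (padIndex m i))) x =
        contract (fun i : Fin (q + 1) → Fin d => T (padIndex (m + 1) i)) x := by
      intro q
      rw [contract_succ]
      simp only [padIndex_cons]
    rw [contract_succ, Fin.sum_univ_succ]
    simp only [Fin.cons_zero, Fin.cons_succ]
    simp only [ih (hsub _), Finset.mul_sum]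
    rw [Finset.sum_comm]
    have hA : ∀ q ∈ Finset.range (m + 1), ∑ a, x a * (x₀ ^ (m - q) * ((m.choose q : ℂ) *
        contract (fun i : Fin q → Fin d => T (Fin.cons a.succ (padIndex m i))) x)) =
        x₀ ^ (m - q) * (m.choose q : ℂ) *
          contract (fun i : Fin (q + 1) → Fin d => T (padIndex (m + 1) i)) x := by
      intro q _
      rw [← h1, Finset.mul_sum]
      exact Finset.sum_congr rfl fun a _ => by ring
    have hB : ∀ q ∈ Finset.range (m + 1), x₀ * (x₀ ^ (m - q) * ((m.choose q : ℂ) *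
        contract (fun i : Fin q → Fin d => T (Fin.cons 0 (padIndex m i))) x)) =
        x₀ ^ (m + 1 - q) * (m.choose q : ℂ) *
          contract (fun i : Fin q → Fin d => T (padIndex (m + 1) i)) x := by
      intro q hq
      have hq' : q ≤ m := Nat.lt_succ_iff.1 (Finset.mem_range.1 hq)
      rw [h0 q hq', Nat.succ_sub hq', pow_succ]
      ring
    rw [Finset.sum_congr rfl hA, Finset.sum_congr rfl hB]
    rw [Finset.sum_range_succ' _ (m + 1), Finset.sum_range_succ' _ m]
    -- The added top term has coefficient binom(m, m + 1) = 0; both sums then have the same range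
    -- and Pascal's rule merges them.
    have hC : ∑ q ∈ Finset.range m, x₀ ^ (m + 1 - (q + 1)) * (m.choose (q + 1) : ℂ) *
          contract (fun i : Fin (q + 1) → Fin d => T (padIndex (m + 1) i)) x =
        ∑ q ∈ Finset.range (m + 1), x₀ ^ (m + 1 - (q + 1)) * (m.choose (q + 1) : ℂ) *
          contract (fun i : Fin (q + 1) → Fin d => T (padIndex (m + 1) i)) x := by
      rw [Finset.sum_range_succ]
      simp
    rw [hC, add_right_comm, ← Finset.sum_add_distrib]
    congr 1
    · refine Finset.sum_congr rfl fun q _ => ?_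
      rw [Nat.choose_succ_succ, Nat.add_sub_add_right]
      push_cast
      ring
    · simp

/-! ### Division by the quadric -/

theorem contract_alternatingSum {d m : ℕ} (T : Tensor (Fin (d + 1)) m) (p : ℕ) (x : Fin d → ℂ) :
    (T.alternatingSum p).contract x = ∑ j ∈ Finset.range (p / 2 + 1),
      (-1) ^ j * ((T.tilde (p - 2 * j)).contract x * (∑ a, x a ^ 2) ^ j) := by
  rw [← Fin.sum_univ_eq_sum_range (fun j => (-1 : ℂ) ^ j *
    ((T.tilde (p - 2 * j)).contract x * (∑ a, x a ^ 2) ^ j))]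
  unfold alternatingSum
  rw [contract]
  simp only [Finset.sum_mul]
  rw [Finset.sum_comm]
  refine Finset.sum_congr rfl fun j _ => ?_
  rw [← contract_iDeltaPow, ← contract_cast (m := p) (by omega), contract, Finset.mul_sum]
  exact Finset.sum_congr rfl fun i _ => by ring

/-- Shifting the summation index by one changes the sign and produces a factor |x|². The resulting
recursion A_{p+2} = f̃^{p+2} − |x|²A_p is that of the quotient coefficients in the division by x₀² +
|x|². -/
theorem contract_alternatingSum_add_two {d m : ℕ} (T : Tensor (Fin (d + 1)) m) (p : ℕ)
    (x : Fin d → ℂ) :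
    (T.tilde (p + 2)).contract x =
      (T.alternatingSum (p + 2)).contract x +
        (∑ a, x a ^ 2) * (T.alternatingSum p).contract x := by
  rw [contract_alternatingSum, contract_alternatingSum, Nat.add_div_right p two_pos,
    Finset.sum_range_succ', Finset.mul_sum, add_right_comm, ← Finset.sum_add_distrib]
  rw [Finset.sum_eq_zero]
  · simp
  · intro j _
    rw [show p + 2 - 2 * (j + 1) = p - 2 * j by omega]
    ring

theorem contract_alternatingSum_of_lt_two {d m : ℕ} (T : Tensor (Fin (d + 1)) m) {p : ℕ}
    (hp : p < 2) (x : Fin d → ℂ) :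
    (T.alternatingSum p).contract x = (T.tilde p).contract x := by
  rw [contract_alternatingSum, Nat.div_eq_of_lt hp]
  simp

/-- Division of the polynomial of `T` by `x₀² + |x|²`. -/
theorem sum_tilde_eq {d m : ℕ} (T : Tensor (Fin (d + 1)) m) (k : ℕ) (x₀ : ℂ) (x : Fin d → ℂ) :
    ∑ q ∈ Finset.range (k + 3), x₀ ^ (k + 2 - q) * (T.tilde q).contract x =
      (x₀ ^ 2 + ∑ a, x a ^ 2) *
        ∑ p ∈ Finset.range (k + 1), x₀ ^ (k - p) * (T.alternatingSum p).contract x +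
      x₀ * (T.alternatingSum (k + 1)).contract x + (T.alternatingSum (k + 2)).contract x := by
  have step : ∀ (n : ℕ) (u : ℕ → ℂ), ∑ q ∈ Finset.range (n + 2), x₀ ^ (n + 1 - q) * u q =
      x₀ * ∑ q ∈ Finset.range (n + 1), x₀ ^ (n - q) * u q + u (n + 1) := by
    intro n u
    rw [Finset.sum_range_succ, Finset.mul_sum]
    congr 1
    · refine Finset.sum_congr rfl fun q hq => ?_
      rw [Nat.succ_sub (Nat.lt_succ_iff.1 (Finset.mem_range.1 hq)), pow_succ]
      ring
    · simp
  induction k with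
  | zero =>
    rw [step, step, contract_alternatingSum_add_two, 
      show (0 + 1 : ℕ) = 1 from rfl, ← contract_alternatingSum_of_lt_two T one_lt_two]
    simp [← contract_alternatingSum_of_lt_two T two_pos]
    ring
  | succ k ih =>
    -- Horner step: x₀ times the old remainder plus f̃^{k+3} is (x₀² + |x|²)A_{k+1}, absorbed by the
    -- quotient, plus the new remainder.
    rw [step, ih, step, contract_alternatingSum_add_two]
    ring

/-- The symmetric `k`-tensor on `ℝ × ℝ^d` whose components with exactly `p` indices different
from the first one are those of `binom(k, k - p)⁻¹ A_p`. -/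
noncomputable def assemble {d : ℕ} (A : (p : ℕ) → Tensor (Fin d) p) (k : ℕ) :
    Tensor (Fin (d + 1)) k := fun i =>
  -- Only the multiset of indices enters, so the result is symmetric for any A; the order chosen by
  -- `toList` is immaterial once A is symmetric.
  let l := ((Finset.univ.val.map i).filterMap
    (fun a : Fin (d + 1) => Fin.cases none some a)).toList
  (k.choose (k - l.length) : ℂ)⁻¹ * A l.length l.get

theorem assemble_isSymmetric {d : ℕ} (A : (p : ℕ) → Tensor (Fin d) p) (k : ℕ) :
    (assemble A k).IsSymmetric := by
  intro π i
  unfold assemble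
  rw [← Multiset.map_map, Multiset.map_univ_val_equiv]

theorem assemble_padIndex {d : ℕ} {A : (p : ℕ) → Tensor (Fin d) p} (hA : ∀ p, (A p).IsSymmetric)
    {k p : ℕ} (hp : p ≤ k) (i : Fin p → Fin d) :
    assemble A k (padIndex k i) = (k.choose (k - p) : ℂ)⁻¹ * A p i := by
  have key : ∀ l : List (Fin d), (l : Multiset (Fin d)) = Finset.univ.val.map i →
      (k.choose (k - l.length) : ℂ)⁻¹ * A l.length l.get =
        (k.choose (k - p) : ℂ)⁻¹ * A p i := by
    intro l hl
    have hlen : l.length = p := by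
      have := congrArg Multiset.card hl
      simpa using this
    subst hlen
    congr 1
    refine (hA _).eq_of_map_univ_eq ?_
    rw [← hl, Fin.univ_val_map, List.ofFn_get]
  unfold assemble
  apply key
  rw [Multiset.coe_toList, map_univ_padIndex hp, Multiset.filterMap_add, Multiset.filterMap_map]
  have h0 : ∀ n, Multiset.filterMap (fun a : Fin (d + 1) => (Fin.cases none some a : Option (Fin d)))
      (Multiset.replicate n 0) = 0 := by
    intro n
    refine Multiset.eq_zero_of_forall_notMem fun a ha => ?_
    obtain ⟨b, hb, hb'⟩ := (Multiset.mem_filterMap _ _).1 ha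
    rw [Multiset.eq_of_mem_replicate hb] at hb'
    simp at hb'
  rw [h0, add_zero]
  exact Multiset.filterMap_some _

theorem assemble_tilde {d : ℕ} {A : (p : ℕ) → Tensor (Fin d) p} (hA : ∀ p, (A p).IsSymmetric)
    {k p : ℕ} (hp : p ≤ k) : (assemble A k).tilde p = A p := by
  funext i
  have : (k.choose p : ℂ) ≠ 0 := by exact_mod_cast (Nat.choose_pos hp).ne'
  rw [tilde, assemble_padIndex hA hp, Nat.choose_symm hp, mul_inv_cancel_left₀ this]

/-- `T` vanishes on the isotropic vectors `(± i |x|, x)` if it does on all `e₁ + i θ`. -/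
theorem contract_isotropic {d m : ℕ} {T : Tensor (Fin (d + 1)) m}
    (h : ∀ θ : EuclideanSpace ℝ (Fin d), ‖θ‖ = 1 → T.contract (complexDirection θ) = 0)
    {x : EuclideanSpace ℝ (Fin d)} (hx : x ≠ 0) {s : ℝ} (hs : s ^ 2 = 1) :
    T.contract (Fin.cons (Complex.I * (s * ‖x‖ : ℝ)) fun a => (x a : ℂ)) = 0 := by
  have hρ : ‖x‖ ≠ 0 := norm_ne_zero_iff.2 hx
  have hs0 : s ≠ 0 := by rintro rfl; norm_num at hs
  have hunit : ‖(-(s * ‖x‖)⁻¹) • x‖ = 1 := by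
    have habs : |s| = 1 := by
      rw [← sq_abs] at hs
      nlinarith [abs_nonneg s]
    rw [norm_smul, norm_neg, norm_inv, norm_mul, norm_norm, Real.norm_eq_abs, habs, one_mul,
      inv_mul_cancel₀ hρ]
  -- The vector is i s|x| (e₁ + iθ) with θ = −x/(s|x|), and s = ±1.
  have hvec : (Fin.cons (Complex.I * (s * ‖x‖ : ℝ)) fun a => (x a : ℂ) : Fin (d + 1) → ℂ) =
      fun a => (Complex.I * (s * ‖x‖ : ℝ)) * complexDirection ((-(s * ‖x‖)⁻¹) • x) a := by
    funext a
    refine Fin.cases ?_ (fun a => ?_) a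
    · simp [complexDirection]
    · have h1 : (s : ℂ) ≠ 0 := by exact_mod_cast hs0
      have h2 : ((‖x‖ : ℝ) : ℂ) ≠ 0 := by exact_mod_cast hρ
      simp only [complexDirection, Fin.cons_succ, PiLp.smul_apply, smul_eq_mul]
      push_cast
      field_simp
      linear_combination (x a : ℂ) * Complex.I_sq
  rw [hvec, contract_smul_vec, h _ hunit, mul_zero]

/-- The remainder of the division is affine in x₀ and vanishes at the two roots ±i|x| of the
quadric. These are distinct because x ≠ 0, which is why positive coordinates are convenient. -/
theorem contract_cons_ofReal_eq {d m : ℕ} {T : Tensor (Fin (d + 1)) m} (hT : T.IsSymmetric)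
    (hd : 0 < d)
    (h : ∀ θ : EuclideanSpace ℝ (Fin d), ‖θ‖ = 1 → T.contract (complexDirection θ) = 0)
    {k : ℕ} (hk : m = k + 2) {x : Fin d → ℝ} (hx : ∀ a, 0 < x a) (x₀ : ℂ) :
    T.contract (Fin.cons x₀ fun a => (x a : ℂ)) = (x₀ ^ 2 + ∑ a, (x a : ℂ) ^ 2) *
      ∑ p ∈ Finset.range (k + 1), x₀ ^ (k - p) *
        (T.alternatingSum p).contract fun a => (x a : ℂ) := by
  have hexp : ∀ z : ℂ, T.contract (Fin.cons z fun a => (x a : ℂ)) =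
      (z ^ 2 + ∑ a, (x a : ℂ) ^ 2) *
        ∑ p ∈ Finset.range (k + 1), z ^ (k - p) *
          ((T.alternatingSum p).contract fun a => (x a : ℂ)) +
      z * ((T.alternatingSum (k + 1)).contract fun a => (x a : ℂ)) +
        ((T.alternatingSum (k + 2)).contract fun a => (x a : ℂ)) := by
    intro z
    rw [hT.contract_cons, ← sum_tilde_eq]
    subst hk
    rfl
  set y : EuclideanSpace ℝ (Fin d) := WithLp.toLp 2 x with hy
  have hy0 : y ≠ 0 := by
    intro h0
    have : y ⟨0, hd⟩ = 0 := by rw [h0]; rfl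
    exact (hx ⟨0, hd⟩).ne' this
  have hnorm : (∑ a, (x a : ℂ) ^ 2) = ((‖y‖ ^ 2 : ℝ) : ℂ) := by
    rw [EuclideanSpace.real_norm_sq_eq]
    push_cast
    rfl
  have hiso : ∀ s : ℝ, s ^ 2 = 1 →
      (Complex.I * (s * ‖y‖ : ℝ)) * ((T.alternatingSum (k + 1)).contract fun a => (x a : ℂ)) +
        ((T.alternatingSum (k + 2)).contract fun a => (x a : ℂ)) = 0 := by
    intro s hs
    have h1 := contract_isotropic h hy0 hs
    have h2 := hexp (Complex.I * (s * ‖y‖ : ℝ))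
    have hz : (Complex.I * (s * ‖y‖ : ℝ)) ^ 2 + ∑ a, (x a : ℂ) ^ 2 = 0 := by
      have : (s : ℂ) ^ 2 = 1 := by exact_mod_cast hs
      rw [hnorm, mul_pow, Complex.I_sq]
      push_cast
      rw [mul_pow, this]
      ring
    rw [hz, zero_mul, zero_add] at h2
    rw [← h2]
    exact h1
  have hp := hiso 1 (by norm_num)
  have hm := hiso (-1) (by norm_num)
  have hI : Complex.I * (‖y‖ : ℂ) ≠ 0 :=
    mul_ne_zero Complex.I_ne_zero (by exact_mod_cast norm_ne_zero_iff.2 hy0)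
  push_cast at hp hm
  have h1 : ((T.alternatingSum (k + 1)).contract fun a => (x a : ℂ)) = 0 :=
    (mul_eq_zero.1 (by linear_combination (hp - hm) / 2 :
      Complex.I * (‖y‖ : ℂ) * ((T.alternatingSum (k + 1)).contract fun a => (x a : ℂ)) = 0)
      ).resolve_left hI
  have h2 : ((T.alternatingSum (k + 2)).contract fun a => (x a : ℂ)) = 0 := by
    linear_combination (hp + hm) / 2
  rw [hexp, h1, h2, mul_zero, add_zero, add_zero]

theorem contract_assemble_cons {d : ℕ} {A : (p : ℕ) → Tensor (Fin d) p}
    (hA : ∀ p, (A p).IsSymmetric) (k : ℕ) (x₀ : ℂ) (x : Fin d → ℂ) :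
    (assemble A k).contract (Fin.cons x₀ x) =
      ∑ p ∈ Finset.range (k + 1), x₀ ^ (k - p) * (A p).contract x := by
  rw [(assemble_isSymmetric A k).contract_cons]
  refine Finset.sum_congr rfl fun p hp => ?_
  rw [assemble_tilde hA (Nat.lt_succ_iff.1 (Finset.mem_range.1 hp))]

/-- A symmetric tensor that vanishes on all vectors `e₁ + i θ` is divisible by `δ`. -/
theorem IsSymmetric.eq_iDelta_assemble {d m : ℕ} {T : Tensor (Fin (d + 1)) m}
    (hT : T.IsSymmetric) (hd : 0 < d)
    (h : ∀ θ : EuclideanSpace ℝ (Fin d), ‖θ‖ = 1 → T.contract (complexDirection θ) = 0)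
    {k : ℕ} (hk : m = k + 2) (i : Fin m → Fin (d + 1)) :
    T i = (assemble T.alternatingSum k).iDelta (i ∘ Fin.cast hk.symm) := by
  have hsym : IsSymmetric fun i : Fin m → Fin (d + 1) =>
      T i - (assemble T.alternatingSum k).iDelta (i ∘ Fin.cast hk.symm) := by
    intro π i
    have := (iDelta_isSymmetric (assemble T.alternatingSum k)).comp_cast hk π i
    simp only [hT π i]
    exact congrArg (T i - ·) this
  refine sub_eq_zero.1 (congrFun (hsym.eq_zero_of_contract ?_) i)
  intro x hx
  have hcons : (fun a => (x a : ℂ)) = Fin.cons (x 0 : ℂ) fun a : Fin d => (x a.succ : ℂ) := by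
    funext a
    refine Fin.cases ?_ (fun a => ?_) a <;> simp
  rw [contract_sub, contract_cast hk, contract_iDelta, hcons, Fin.sum_univ_succ,
    contract_cons_ofReal_eq hT hd h hk fun a => hx a.succ,
    contract_assemble_cons hT.alternatingSum]
  ring

/-- A symmetric tensor of order at most one that vanishes on all vectors `e₁ + i θ` is zero. -/
theorem IsSymmetric.eq_zero_of_le_one {d m : ℕ} {T : Tensor (Fin (d + 1)) m}
    (hT : T.IsSymmetric) (hd : 0 < d)
    (h : ∀ θ : EuclideanSpace ℝ (Fin d), ‖θ‖ = 1 → T.contract (complexDirection θ) = 0)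
    (hm : m ≤ 1) : T = 0 := by
  refine hT.eq_zero_of_contract ?_
  intro x hx
  have hcons : (fun a => (x a : ℂ)) = Fin.cons (x 0 : ℂ) fun a : Fin d => (x a.succ : ℂ) := by
    funext a
    refine Fin.cases ?_ (fun a => ?_) a <;> simp
  set y : EuclideanSpace ℝ (Fin d) := WithLp.toLp 2 fun a => x a.succ with hy
  have hy0 : y ≠ 0 := by
    intro h0
    have : y ⟨0, hd⟩ = 0 := by rw [h0]; rfl
    exact (hx _).ne' this
  have hiso : ∀ s : ℝ, s ^ 2 = 1 → T.contract (Fin.cons (Complex.I * (s * ‖y‖ : ℝ))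
      fun a => (x a.succ : ℂ)) = 0 := fun s hs => contract_isotropic h hy0 hs
  have hp := hiso 1 (by norm_num)
  have hn := hiso (-1) (by norm_num)
  have hI : Complex.I * (‖y‖ : ℂ) ≠ 0 :=
    mul_ne_zero Complex.I_ne_zero (by exact_mod_cast norm_ne_zero_iff.2 hy0)
  rw [hcons]
  rw [hT.contract_cons] at hp hn ⊢
  interval_cases m
  · simpa using hp
  · simp only [Finset.sum_range_succ, Finset.sum_range_zero, zero_add] at hp hn ⊢
    push_cast at hp hn
    norm_num at hp hn ⊢
    have h1 : ((T.tilde 0).contract fun a => (x a.succ : ℂ)) = 0 :=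
      (mul_eq_zero.1 (by linear_combination (hp - hn) / 2 :
        Complex.I * (‖y‖ : ℂ) * ((T.tilde 0).contract fun a => (x a.succ : ℂ)) = 0)).resolve_left hI
    rw [h1] at hp ⊢
    linear_combination hp

end Tensor

/-! ### Injectivity of the Fourier transform on L¹ -/

/-- Write a test function g as the transform of a Schwartz function H; then ∫ F g = ∫ F̂ H = 0. -/
theorem ae_eq_zero_of_integral_exp_mul_eq_zero {E : Type*} [NormedAddCommGroup E]
    [InnerProductSpace ℝ E] [FiniteDimensional ℝ E] [MeasurableSpace E] [BorelSpace E]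
    {F : E → ℂ} (hF : Integrable F)
    (h : ∀ ξ : E, ∫ x, Complex.exp (-(inner ℝ x ξ : ℝ) * Complex.I) * F x = 0) :
    ∀ᵐ x, F x = 0 := by
  have hfour : ∀ w : E, FourierTransform.fourier F w = 0 := by
    intro w
    rw [Real.fourier_eq', ← h ((2 * Real.pi) • w)]
    refine integral_congr_ae (Filter.Eventually.of_forall fun x => ?_)
    simp only [inner_smul_right, smul_eq_mul]
    congr 3
    push_cast
    ring
  refine ae_eq_zero_of_integral_contDiff_smul_eq_zero hF.locallyIntegrable ?_
  intro g hg hgc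
  have hg₁ : HasCompactSupport (Complex.ofRealCLM ∘ g) := hgc.comp_left rfl
  have hg₂ : ContDiff ℝ (⊤ : ℕ∞) (Complex.ofRealCLM ∘ g) := Complex.ofRealCLM.contDiff.comp hg
  let G : SchwartzMap E ℂ := hg₁.toSchwartzMap hg₂
  let H : SchwartzMap E ℂ := FourierTransformInv.fourierInv G
  have hH : FourierTransform.fourier (H : E → ℂ) = G := by
    rw [← SchwartzMap.fourier_coe]
    simp [H]
  have := VectorFourier.integral_fourierIntegral_smul_eq_flip (L := innerₗ E) (μ := volume)
    (ν := volume) (f := F) (g := H) Real.continuous_fourierChar continuous_inner hF H.integrable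
  have hflip : ∀ x, VectorFourier.fourierIntegral Real.fourierChar volume (innerₗ E).flip H x =
      (g x : ℂ) := by
    intro x
    have h1 : FourierTransform.fourier (H : E → ℂ) x = (g x : ℂ) := by
      rw [hH]
      rfl
    rw [← h1, flip_innerₗ]
    rfl
  have hl : ∀ ξ, VectorFourier.fourierIntegral Real.fourierChar volume (innerₗ E) F ξ = 0 := hfour
  simp only [hl, hflip, zero_smul, integral_zero] at this
  rw [this]
  refine integral_congr_ae (Filter.Eventually.of_forall fun x => ?_)
  simp [mul_comm]

/-! ### Trigonometric polynomials on great circles -/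

open Polynomial in
-- The bound forces Q(±1) = 0 by continuity along the circle; divide by z² − 1 and repeat. The
-- points ±1 are excluded from the hypothesis because the bound on the quotient is only available
-- away from them.
theorem Polynomial.sq_sub_one_pow_dvd {c : ℝ} (k : ℕ) (Q : ℂ[X])
    (h : ∀ z : ℂ, ‖z‖ = 1 → z ^ 2 ≠ 1 → ‖Q.eval z‖ ≤ c * ‖z ^ 2 - 1‖ ^ k) :
    (X ^ 2 - 1) ^ k ∣ Q := by
  induction k generalizing Q with
  | zero => simp
  | succ k ih =>
    have hroot : ∀ a : ℂ, a = 1 ∨ a = -1 → Q.eval a = 0 := by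
      intro a ha
      let z : ℝ → ℂ := fun φ => a * Complex.exp (φ * Complex.I)
      have hz : Continuous z := by fun_prop
      have hz0 : z 0 = a := by simp [z]
      have ha2 : a ^ 2 = 1 := by rcases ha with rfl | rfl <;> norm_num
      have hlim1 : Filter.Tendsto (fun φ => ‖Q.eval (z φ)‖) (nhdsWithin 0 (Set.Ioi 0))
          (nhds ‖Q.eval a‖) := by
        have : Continuous fun φ => ‖Q.eval (z φ)‖ := (Q.continuous.comp hz).norm
        have h0 := this.tendsto 0
        rw [hz0] at h0
        exact h0.mono_left nhdsWithin_le_nhds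
      have hlim2 : Filter.Tendsto (fun φ => c * ‖z φ ^ 2 - 1‖ ^ (k + 1))
          (nhdsWithin 0 (Set.Ioi 0)) (nhds 0) := by
        have : Continuous fun φ => c * ‖z φ ^ 2 - 1‖ ^ (k + 1) := by fun_prop
        have h0 := this.tendsto 0
        rw [hz0, ha2, sub_self, norm_zero, zero_pow (Nat.succ_ne_zero k), mul_zero] at h0
        exact h0.mono_left nhdsWithin_le_nhds
      have hle : ‖Q.eval a‖ ≤ 0 := by
        refine le_of_tendsto_of_tendsto hlim1 hlim2 ?_
        filter_upwards [Ioo_mem_nhdsGT Real.pi_pos] with φ hφ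
        refine h _ ?_ ?_
        · have : ‖a‖ = 1 := by rcases ha with rfl | rfl <;> simp
          simp [z, Complex.norm_exp_ofReal_mul_I, this]
        · intro hsq
          have hs : Real.sin φ ≠ 0 := (Real.sin_pos_of_pos_of_lt_pi hφ.1 hφ.2).ne'
          have him : Complex.exp (φ * Complex.I) ^ 2 = 1 := by
            rw [← hsq, mul_pow, ha2, one_mul]
          have him' : (Complex.exp (φ * Complex.I)).im = 0 := by
            rcases (sq_eq_sq_iff_eq_or_eq_neg.1 (him.trans (one_pow 2).symm)) with h | h <;> rw [h] <;> simp
          rw [Complex.exp_ofReal_mul_I_im] at him'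
          exact hs him'
      exact norm_le_zero_iff.1 hle
    have hfac : (X ^ 2 - 1 : ℂ[X]) = (X - C 1) * (X - C (-1)) := by
      simp only [map_neg, map_one]
      ring
    have hdvd : (X ^ 2 - 1 : ℂ[X]) ∣ Q := by
      rw [hfac]
      refine IsCoprime.mul_dvd ?_ (dvd_iff_isRoot.2 (hroot 1 (Or.inl rfl)))
        (dvd_iff_isRoot.2 (hroot (-1) (Or.inr rfl)))
      exact isCoprime_X_sub_C_of_isUnit_sub (by norm_num)
    obtain ⟨P, rfl⟩ := hdvd
    rw [pow_succ']
    refine mul_dvd_mul_left _ (ih P ?_)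
    intro z hz hz1
    have hpos : 0 < ‖z ^ 2 - 1‖ := norm_pos_iff.2 (sub_ne_zero.2 hz1)
    have := h z hz hz1
    simp only [eval_mul, eval_sub, eval_pow, eval_X, eval_one, norm_mul] at this
    refine le_of_mul_le_mul_left (this.trans (le_of_eq ?_)) hpos
    ring

open Polynomial in
/-- A trigonometric polynomial of degree `m` cannot vanish to order `m + 1` at two opposite
points of the circle. -/
theorem Polynomial.eq_zero_of_norm_eval_le {c : ℝ} {m : ℕ} {Q : ℂ[X]} (hdeg : Q.natDegree ≤ m * 2)
    (h : ∀ z : ℂ, ‖z‖ = 1 → ‖Q.eval z‖ ≤ c * ‖z ^ 2 - 1‖ ^ (m + 1)) : Q = 0 := by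
  refine eq_zero_of_dvd_of_natDegree_lt (Q.sq_sub_one_pow_dvd (m + 1) fun z hz _ => h z hz) ?_
  have : (X ^ 2 - 1 : ℂ[X]).natDegree = 2 := natDegree_X_pow_sub_C (n := 2) (r := (1 : ℂ))
  rw [natDegree_pow, this]
  omega

open Polynomial in
-- With θ = cos φ ω + sin φ u and z = e^{iφ}, z^m times the contraction is a polynomial of degree at
-- most 2m in z, while |⟨u, θ⟩| = |sin φ| = |z² − 1|/2.
theorem Tensor.contract_complexDirection_eq_zero_of_circle {d m : ℕ} (T : Tensor (Fin (d + 1)) m)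
    {c : ℝ} (hc : 0 ≤ c) {u ω : EuclideanSpace ℝ (Fin d)} (hu : ‖u‖ = 1) (hω : ‖ω‖ = 1)
    (huω : inner ℝ u ω = 0)
    (h : ∀ θ : EuclideanSpace ℝ (Fin d), ‖θ‖ = 1 →
      ‖T.contract (complexDirection θ)‖ ≤ c * |inner ℝ u θ| ^ (m + 1))
    {a b : ℝ} (hab : a ^ 2 + b ^ 2 = 1) :
    T.contract (complexDirection (a • ω + b • u)) = 0 := by
  -- The components of z(e₁ + iθ), from z cos φ = (z² + 1)/2 and i z sin φ = (z² − 1)/2.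
  let p : Fin (d + 1) → ℂ[X] := Fin.cons X fun k =>
    C (Complex.I / 2 * ω k) * (X ^ 2 + 1) + C (u k / 2 : ℂ) * (X ^ 2 - 1)
  let Q : ℂ[X] := ∑ i : Fin m → Fin (d + 1), C (T i) * ∏ j, p (i j)
  have hp : ∀ k, (p k).natDegree ≤ 2 := by
    intro k
    refine Fin.cases ?_ (fun k => ?_) k
    · simp [p]
    · simp only [p, Fin.cons_succ]
      compute_degree
  have hdeg : Q.natDegree ≤ m * 2 := by
    refine natDegree_sum_le_of_forall_le _ _ fun i _ => ?_
    refine (natDegree_C_mul_le _ _).trans ((natDegree_prod_le _ _).trans ?_)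
    refine (Finset.sum_le_card_nsmul _ _ 2 fun j _ => hp _).trans ?_
    simp
  have heval : ∀ z : ℂ, ‖z‖ = 1 → Q.eval z =
      z ^ m * T.contract (complexDirection (z.re • ω + z.im • u)) := by
    intro z hz
    have hzz : z * (starRingEnd ℂ) z = 1 := by
      rw [Complex.mul_conj, Complex.normSq_eq_norm_sq, hz]
      norm_num
    rw [← contract_smul_vec]
    simp only [Q, contract, eval_finsetSum, eval_mul, eval_C, eval_prod]
    refine Finset.sum_congr rfl fun i _ => ?_
    congr 1
    refine Finset.prod_congr rfl fun j _ => ?_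
    refine Fin.cases ?_ (fun k => ?_) (i j)
    · simp [p, complexDirection]
    · simp only [p, complexDirection, Fin.cons_succ, eval_add, eval_mul, eval_C, eval_pow, eval_X,
        eval_one, eval_sub, PiLp.add_apply, PiLp.smul_apply, smul_eq_mul]
      push_cast
      rw [Complex.re_eq_add_conj, Complex.im_eq_sub_conj]
      field_simp
      linear_combination (-Complex.I * ω k  + u k) * hzz
  have hnorm : ∀ a b : ℝ, a ^ 2 + b ^ 2 = 1 → ‖a • ω + b • u‖ = 1 := by
    intro a b hab
    have : ‖a • ω + b • u‖ ^ 2 = 1 := by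
      rw [@norm_add_sq_real, norm_smul, norm_smul, hu, hω, inner_smul_left, inner_smul_right,
        real_inner_comm, huω]
      simp [hab]
    nlinarith [norm_nonneg (a • ω + b • u)]
  have hinner : ∀ a b : ℝ, inner ℝ u (a • ω + b • u) = b := by
    intro a b
    rw [inner_add_right, inner_smul_right, inner_smul_right, huω, real_inner_self_eq_norm_sq, hu]
    simp
  have hsq : ∀ z : ℂ, ‖z‖ = 1 → z.re ^ 2 + z.im ^ 2 = 1 := by
    intro z hz
    have := Complex.normSq_eq_norm_sq z
    rw [Complex.normSq_apply, hz] at this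
    linarith
  have hQ : Q = 0 := by
    refine eq_zero_of_norm_eval_le (c := c) hdeg fun z hz => ?_
    rw [heval z hz, norm_mul, norm_pow, hz, one_pow, one_mul]
    refine (h _ (hnorm _ _ (hsq z hz))).trans ?_
    rw [hinner]
    gcongr
    have : z ^ 2 - 1 = z * (2 * z.im * Complex.I) := by
      have hzz : z * (starRingEnd ℂ) z = 1 := by
        rw [Complex.mul_conj, Complex.normSq_eq_norm_sq, hz]
        norm_num
      have h2 : (2 * z.im * Complex.I : ℂ) = z - (starRingEnd ℂ) z := by
        rw [Complex.sub_conj]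
        push_cast
        ring
      rw [h2]
      linear_combination hzz
    rw [this, norm_mul, hz, one_mul]
    simp only [norm_mul, Complex.norm_I, Complex.norm_real, Real.norm_eq_abs]
    norm_num
    linarith [abs_nonneg z.im]
  have hz : ‖(⟨a, b⟩ : ℂ)‖ = 1 := by
    rw [Complex.norm_eq_sqrt_sq_add_sq, hab, Real.sqrt_one]
  have := heval ⟨a, b⟩ hz
  rw [hQ, eval_zero] at this
  refine (mul_eq_zero.1 this.symm).resolve_left (pow_ne_zero _ ?_)
  rw [← norm_ne_zero_iff, hz]
  exact one_ne_zero

theorem exists_orthogonal_decomposition {d : ℕ} (hd : 2 ≤ d) {u θ : EuclideanSpace ℝ (Fin d)}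
    (hu : ‖u‖ = 1) (hθ : ‖θ‖ = 1) :
    ∃ (ω : EuclideanSpace ℝ (Fin d)) (a b : ℝ), ‖ω‖ = 1 ∧ inner ℝ u ω = 0 ∧ a ^ 2 + b ^ 2 = 1 ∧
      θ = a • ω + b • u := by
  have key : ∃ (ω : EuclideanSpace ℝ (Fin d)) (a b : ℝ), ‖ω‖ = 1 ∧ inner ℝ u ω = 0 ∧
      θ = a • ω + b • u := by
    set w := θ - (inner ℝ u θ : ℝ) • u with hw
    have hwu : inner ℝ u w = 0 := by
      rw [hw, inner_sub_right, inner_smul_right, real_inner_self_eq_norm_sq, hu]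
      simp
    by_cases h0 : w = 0
    -- Here θ is a multiple of u, so ω is any unit vector orthogonal to u; one exists because d ≥ 2.
    · have hpos : 0 < Module.finrank ℝ (Submodule.span ℝ {u})ᗮ := by
        have h1 := (Submodule.span ℝ {u}).finrank_add_finrank_orthogonal
        have h2 : Module.finrank ℝ (Submodule.span ℝ {u}) ≤ 1 := by
          simpa using finrank_span_le_card (R := ℝ) {u}
        rw [finrank_euclideanSpace_fin] at h1
        omega
      have := Module.finrank_pos_iff.1 hpos
      obtain ⟨⟨v, hv⟩, hv0⟩ := exists_ne (0 : (Submodule.span ℝ {u})ᗮ)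
      have hvn : v ≠ 0 := fun h => hv0 (Subtype.ext h)
      have hvu : inner ℝ u v = 0 := Submodule.mem_orthogonal_singleton_iff_inner_right.1 hv
      refine ⟨‖v‖⁻¹ • v, 0, inner ℝ u θ, norm_smul_inv_norm hvn, ?_, ?_⟩
      · rw [inner_smul_right, hvu, mul_zero]
      · rw [zero_smul, zero_add]
        exact sub_eq_zero.1 h0
    · refine ⟨‖w‖⁻¹ • w, ‖w‖, inner ℝ u θ, norm_smul_inv_norm h0, ?_, ?_⟩
      · rw [inner_smul_right, hwu, mul_zero]
      · rw [smul_inv_smul₀ (norm_ne_zero_iff.2 h0), hw, sub_add_cancel]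
  obtain ⟨ω, a, b, hω, huω, rfl⟩ := key
  refine ⟨ω, a, b, hω, huω, ?_, rfl⟩
  have : ‖a • ω + b • u‖ ^ 2 = 1 := by rw [hθ, one_pow]
  rw [@norm_add_sq_real, norm_smul, norm_smul, hu, hω, inner_smul_left, inner_smul_right,
    real_inner_comm, huω] at this
  simpa using this

theorem Tensor.contract_complexDirection_eq_zero {d m : ℕ} (hd : 2 ≤ d)
    (T : Tensor (Fin (d + 1)) m) {c : ℝ} (hc : 0 ≤ c) {ξ : EuclideanSpace ℝ (Fin d)} (hξ : ξ ≠ 0)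
    (h : ∀ θ : EuclideanSpace ℝ (Fin d), ‖θ‖ = 1 →
      ‖T.contract (complexDirection θ)‖ ≤ c * |inner ℝ ξ θ| ^ (m + 1))
    {θ : EuclideanSpace ℝ (Fin d)} (hθ : ‖θ‖ = 1) : T.contract (complexDirection θ) = 0 := by
  have hu : ‖‖ξ‖⁻¹ • ξ‖ = 1 := norm_smul_inv_norm hξ
  obtain ⟨ω, a, b, hω, huω, hab, rfl⟩ := exists_orthogonal_decomposition hd hu hθ
  refine T.contract_complexDirection_eq_zero_of_circle (c := c * ‖ξ‖ ^ (m + 1)) (by positivity)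
    hu hω huω (fun θ hθ => (h θ hθ).trans (le_of_eq ?_)) hab
  rw [inner_smul_left, abs_mul, mul_pow, mul_assoc, ← mul_assoc (‖ξ‖ ^ (m + 1)), ← mul_pow]
  simp [norm_ne_zero_iff.2 hξ]

/-! ### From ray moments to decay of the Fourier transform -/

/-- If the ray moments of order at most `m` of a function supported in the ball of radius `R`
vanish in the direction `θ`, then its Fourier transform vanishes to order `m + 1` on `θ^⊥`. -/
theorem norm_integral_exp_mul_le {E : Type*} [NormedAddCommGroup E]
    [InnerProductSpace ℝ E] [FiniteDimensional ℝ E] [MeasurableSpace E] [BorelSpace E]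
    {F : E → ℂ} (hF : Integrable F) {R : ℝ} (hR : 0 ≤ R) (hsupp : ∀ x, R < ‖x‖ → F x = 0)
    {θ : E} (hθ : ‖θ‖ = 1) {m : ℕ}
    (hmom : ∀ᵐ y, R < ‖y‖ → ∀ α ≤ m,
      ∫ r in Set.Ioi (0 : ℝ), (r : ℂ) ^ α * F (y + r • θ) = 0) (ξ : E) :
    ‖∫ x, Complex.exp (-(inner ℝ x ξ : ℝ) * Complex.I) * F x‖ ≤
      (|inner ℝ θ ξ| * (2 * R + 2)) ^ (m + 1) * Real.exp (|inner ℝ θ ξ| * (2 * R + 2)) *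
        ∫ x, ‖F x‖ := by
  set τ : ℝ := inner ℝ θ ξ with hτ
  set e : E → ℂ := fun y => Complex.exp (-(inner ℝ y ξ : ℝ) * Complex.I) with he
  -- Taylor polynomial of e^{−irτ} of degree m: its products with F along a ray involve only moments
  -- of order at most m.
  set p : ℝ → ℂ := fun r => ∑ α ∈ Finset.range (m + 1),
    (-(r * τ : ℝ) * Complex.I) ^ α / (α.factorial : ℂ) with hp
  -- A slab of centres of thickness one, outside the ball. A ray in direction θ from S reaches a
  -- point of the ball at some r in [1, 2R + 2] and has left the ball for r > 2R + 2.
  set S : Set E := {y | inner ℝ y θ ∈ Set.Icc (-(R + 2)) (-(R + 1))} with hS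
  set μ : Measure ℝ := volume.restrict (Set.Ioc 0 (2 * R + 2)) with hμ
  set M : ℝ := (|τ| * (2 * R + 2)) ^ (m + 1) * Real.exp (|τ| * (2 * R + 2)) with hM
  have he1 : ∀ y, ‖e y‖ = 1 := by
    intro y
    have := Complex.norm_exp_ofReal_mul_I (-(inner ℝ y ξ))
    simpa [he] using this
  have hec : Continuous e := by fun_prop
  have hpc : Continuous p := by fun_prop
  have heshift : ∀ x (r : ℝ), e (x - r • θ) = e x * Complex.exp ((r * τ : ℝ) * Complex.I) := by
    intro x r
    simp only [he, ← Complex.exp_add, inner_sub_left, inner_smul_left]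
    congr 1
    simp [hτ]
    ring
  have hSm : MeasurableSet S := by
    have : Continuous fun y : E => (inner ℝ y θ : ℝ) := by fun_prop
    exact this.measurable measurableSet_Icc
  have hprem : ∀ r ∈ Set.Ioc 0 (2 * R + 2), ‖Complex.exp (-(r * τ : ℝ) * Complex.I) - p r‖ ≤ M := by
    intro r hr
    have hn : ‖(-(r * τ : ℝ) * Complex.I : ℂ)‖ ≤ |τ| * (2 * R + 2) := by
      rw [norm_mul, Complex.norm_I, mul_one, norm_neg, Complex.norm_real, Real.norm_eq_abs, abs_mul,
        abs_of_pos hr.1, mul_comm]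
      gcongr
      exact hr.2
    refine (Complex.norm_exp_sub_sum_le_norm_mul_exp _ (m + 1)).trans ?_
    rw [hM]
    gcongr
  have hinner : ∀ y : E, |inner ℝ y θ| ≤ ‖y‖ := by
    intro y
    simpa [hθ] using abs_real_inner_le_norm y θ
  have hSnorm : ∀ y ∈ S, R < ‖y‖ := by
    intro y hy
    have h1 := hinner y
    have h2 := neg_abs_le (inner ℝ y θ)
    have h3 := hy.2
    linarith
  have hθθ : (inner ℝ θ θ : ℝ) = 1 := by rw [real_inner_self_eq_norm_sq, hθ, one_pow]
  -- the kernel on the slab, before and after the shear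
  set q : ℝ × E → ℂ := fun z => (Prod.snd ⁻¹' S).indicator (fun z => e z.2 * p z.1) z with hq
  have hqm : Measurable q := by
    refine Measurable.indicator ?_ (measurable_snd hSm)
    exact ((hec.comp continuous_snd).mul (hpc.comp continuous_fst)).measurable
  have hq1 : ∀ (r : ℝ) y, y ∈ S → q (r, y) = e y * p r := fun r y hy =>
    Set.indicator_of_mem (by exact hy) _
  have hq0 : ∀ (r : ℝ) y, y ∉ S → q (r, y) = 0 := fun r y hy =>
    Set.indicator_of_notMem (by exact hy) _
  obtain ⟨B, hB⟩ := (isCompact_Icc (a := (0 : ℝ)) (b := 2 * R + 2)).exists_bound_of_continuousOn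
    hpc.continuousOn
  have hB0 : 0 ≤ max B 0 := le_max_right _ _
  have hqB : ∀ z : ℝ × E, z.1 ∈ Set.Ioc 0 (2 * R + 2) → ‖q z‖ ≤ max B 0 := by
    rintro ⟨r, y⟩ hr
    by_cases hy : y ∈ S
    · rw [hq1 r y hy, norm_mul, he1, one_mul]
      exact (hB _ (Set.Ioc_subset_Icc_self hr)).trans (le_max_left _ _)
    · rw [hq0 r y hy, norm_zero]
      exact hB0
  have hIae : ∀ᵐ z ∂(μ.prod (volume : Measure E)), z.1 ∈ Set.Ioc 0 (2 * R + 2) :=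
    Measure.quasiMeasurePreserving_fst.ae (ae_restrict_mem measurableSet_Ioc)
  have hshear : MeasurePreserving (fun z : ℝ × E => (z.1, z.2 + z.1 • θ))
      (μ.prod volume) (μ.prod volume) :=
    (MeasurePreserving.id μ).skew_product (g := fun r y => y + r • θ) (by fun_prop)
      (Filter.Eventually.of_forall fun r => map_add_right_eq_self volume (r • θ))
  have hFsnd : Integrable (fun z : ℝ × E => F z.2) (μ.prod volume) := hF.comp_snd μ
  have hFshear : Integrable (fun z : ℝ × E => F (z.2 + z.1 • θ)) (μ.prod volume) :=
    hshear.integrable_comp_of_integrable hFsnd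
  have hΦ : Integrable (fun z : ℝ × E => q z * F (z.2 + z.1 • θ)) (μ.prod volume) :=
    hFshear.bdd_mul hqm.aestronglyMeasurable (hIae.mono hqB)
  have hΨ : Integrable (fun z : ℝ × E => q (z.1, z.2 - z.1 • θ) * F z.2) (μ.prod volume) := by
    refine hFsnd.bdd_mul (c := max B 0) (Measurable.aestronglyMeasurable ?_) (hIae.mono ?_)
    · exact hqm.comp (by fun_prop)
    · exact fun z hz => hqB _ hz
  -- The shear x = y + rθ turns the integral over rays, which vanishes, into an integral of F
  -- against a kernel close to e.
  have hswap : ∫ y, ∫ r, q (r, y) * F (y + r • θ) ∂μ =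
      ∫ x, ∫ r, q (r, x - r • θ) * F x ∂μ := by
    rw [← integral_integral_swap (f := fun r y => q (r, y) * F (y + r • θ)) hΦ,
      ← integral_integral_swap (f := fun r x => q (r, x - r • θ) * F x) hΨ]
    refine integral_congr_ae (Filter.Eventually.of_forall fun r => ?_)
    have := integral_add_right_eq_self (μ := (volume : Measure E))
      (fun x => q (r, x - r • θ) * F x) (r • θ)
    simpa using this
  have hzero : ∫ y, ∫ r, q (r, y) * F (y + r • θ) ∂μ = 0 := by
    refine integral_eq_zero_of_ae ?_
    filter_upwards [hmom, hFshear.prod_left_ae] with y hy hint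
    by_cases hyS : y ∈ S
    · have hq' : ∀ r, q (r, y) * F (y + r • θ) = ∑ α ∈ Finset.range (m + 1),
          (e y * ((-τ * Complex.I) ^ α / (α.factorial : ℂ))) * ((r : ℂ) ^ α * F (y + r • θ)) := by
        intro r
        rw [hq1 r y hyS, hp, Finset.mul_sum, Finset.sum_mul]
        refine Finset.sum_congr rfl fun α _ => ?_
        have : (-((r * τ : ℝ) : ℂ) * Complex.I) ^ α = (-τ * Complex.I) ^ α * (r : ℂ) ^ α := by
          rw [← mul_pow]
          push_cast
          ring
        simp only [this]
        ring
      simp only [hq', Pi.zero_apply]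
      rw [integral_finsetSum]
      · refine Finset.sum_eq_zero fun α hα => ?_
        rw [integral_const_mul]
        have hα' := hy (hSnorm y hyS) α (Nat.lt_succ_iff.1 (Finset.mem_range.1 hα))
        rw [setIntegral_eq_of_subset_of_forall_sdiff_eq_zero measurableSet_Ioi
          (s := Set.Ioc 0 (2 * R + 2)) Set.Ioc_subset_Ioi_self] at hα'
        · rw [hμ, hα', mul_zero]
        · intro r hr
          have hr2 : 2 * R + 2 < r := by
            by_contra hcon
            exact hr.2 ⟨hr.1, not_lt.1 hcon⟩
          rw [hsupp, mul_zero]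
          have h1 := hinner (y + r • θ)
          rw [inner_add_left, inner_smul_left, hθθ] at h1
          have h2 := le_abs_self ((inner ℝ y θ : ℝ) + (starRingEnd ℝ) r * 1)
          have h3 := hyS.1
          simp only [conj_trivial, mul_one] at h1 h2
          linarith
      · intro α _
        refine Integrable.const_mul ?_ _
        refine hint.bdd_mul (c := (2 * R + 2) ^ α) (by fun_prop) ?_
        filter_upwards [ae_restrict_mem measurableSet_Ioc] with r hr
        rw [norm_pow, Complex.norm_real, Real.norm_eq_abs, abs_of_pos hr.1]
        exact pow_le_pow_left₀ hr.1.le hr.2 α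
    · simp [fun r => hq0 r y hyS]
  -- For x in the ball the admissible r form an interval of length one, on which the kernel is
  -- e(x)e^{irτ}p(r); this differs from e(x) by at most M.
  have hbound : ∀ x, ‖e x * F x - ∫ r, q (r, x - r • θ) * F x ∂μ‖ ≤ M * ‖F x‖ := by
    intro x
    by_cases hx : R < ‖x‖
    · simp [hsupp x hx]
    have hxθ := abs_le.1 ((hinner x).trans (not_lt.1 hx))
    set a : ℝ := inner ℝ x θ + R + 1 with ha
    have hsub : Set.Icc a (a + 1) ⊆ Set.Ioc 0 (2 * R + 2) := by
      intro r hr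
      constructor <;> linarith [hr.1, hr.2, hxθ.1, hxθ.2]
    have hind : ∀ r, q (r, x - r • θ) * F x = (Set.Icc a (a + 1)).indicator
        (fun r => e x * Complex.exp ((r * τ : ℝ) * Complex.I) * p r * F x) r := by
      intro r
      have hmem : x - r • θ ∈ S ↔ r ∈ Set.Icc a (a + 1) := by
        simp only [hS, Set.mem_ofPred_eq, Set.mem_Icc, inner_sub_left, inner_smul_left, hθθ, ha,
          conj_trivial, mul_one]
        constructor <;> rintro ⟨h1, h2⟩ <;> constructor <;> linarith
      by_cases hr : r ∈ Set.Icc a (a + 1)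
      · rw [Set.indicator_of_mem hr, hq1 _ _ (hmem.2 hr), ← heshift]
      · rw [Set.indicator_of_notMem hr, hq0 _ _ fun h => hr (hmem.1 h), zero_mul]
    have hvol : volume.real (Set.Icc a (a + 1)) = 1 := by simp
    have hconst : e x * F x = ∫ _ in Set.Icc a (a + 1), e x * F x := by
      rw [setIntegral_const, hvol, one_smul]
    simp only [hind]
    rw [hμ, setIntegral_indicator measurableSet_Icc, Set.inter_eq_right.2 hsub, hconst,
      ← integral_sub]
    · refine (norm_setIntegral_le_of_norm_le_const (C := M * ‖F x‖) (by simp) ?_).trans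
        (le_of_eq (by rw [hvol, mul_one]))
      intro r hr
      have hsplit : e x * F x - e x * Complex.exp ((r * τ : ℝ) * Complex.I) * p r * F x =
          e x * Complex.exp ((r * τ : ℝ) * Complex.I) *
            (Complex.exp (-(r * τ : ℝ) * Complex.I) - p r) * F x := by
        have : Complex.exp ((r * τ : ℝ) * Complex.I) * Complex.exp (-(r * τ : ℝ) * Complex.I) = 1 := by
          rw [← Complex.exp_add, neg_mul, add_neg_cancel, Complex.exp_zero]
        linear_combination (-(e x * F x)) * this
      rw [hsplit, norm_mul, norm_mul, norm_mul, he1, Complex.norm_exp_ofReal_mul_I, one_mul, one_mul]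
      exact mul_le_mul_of_nonneg_right (hprem r (hsub hr)) (norm_nonneg _)
    · exact integrableOn_const (by simp)
    · exact Continuous.integrableOn_Icc (by fun_prop)
  have heF : Integrable fun x => e x * F x :=
    hF.bdd_mul (c := 1) hec.aestronglyMeasurable (Filter.Eventually.of_forall fun x => (he1 x).le)
  have hmain : ∫ x, e x * F x = ∫ x, (e x * F x - ∫ r, q (r, x - r • θ) * F x ∂μ) := by
    rw [integral_sub heF hΨ.integral_prod_right, ← hswap, hzero, sub_zero]
  rw [hmain, ← integral_const_mul]
  exact norm_integral_le_of_norm_le (hF.norm.const_mul M) (Filter.Eventually.of_forall hbound)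

/-! ### Exceptional sets of directions and centres -/

/-- In polar coordinates the volume has a positive radial density on r > 0. This allows f(0, ·) to
be replaced by a measurable representative without changing the moments for a.e. θ. -/
theorem ae_toSphere_ae_ray {E : Type*} [NormedAddCommGroup E] [InnerProductSpace ℝ E]
    [FiniteDimensional ℝ E] [MeasurableSpace E] [BorelSpace E]
    {P : E → Prop} (h : ∀ᵐ x, P x) (x₀ : E) :
    ∀ᵐ θ : Metric.sphere (0 : E) 1 ∂(volume : Measure E).toSphere,
      ∀ᵐ r ∂(volume.restrict (Set.Ioi (0 : ℝ))), P (x₀ + r • θ.1) := by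
  have h1 : ∀ᵐ x : E, P (x₀ + x) :=
    (measurePreserving_add_left volume x₀).quasiMeasurePreserving.ae h
  have h2 : ∀ᵐ x : ({0}ᶜ : Set E) ∂(Measure.comap Subtype.val volume), P (x₀ + x.1) := by
    have hm : MeasurableSet ({0}ᶜ : Set E) := (measurableSet_singleton _).compl
    rw [← (MeasurableEmbedding.subtype_coe hm).ae_map_iff (p := fun x => P (x₀ + x)),
      map_comap_subtype_coe hm]
    exact ae_restrict_of_ae h1
  have hpres := (volume : Measure E).measurePreserving_homeomorphUnitSphereProd
  have h3 := (hpres.symm (homeomorphUnitSphereProd E).toMeasurableEquiv).quasiMeasurePreserving.ae h2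
  filter_upwards [Measure.ae_ae_of_ae_prod h3] with θ hθ
  rw [Measure.volumeIoiPow, ae_withDensity_iff (by fun_prop)] at hθ
  rw [← map_comap_subtype_coe measurableSet_Ioi,
    (MeasurableEmbedding.subtype_coe measurableSet_Ioi).ae_map_iff]
  filter_upwards [hθ] with r hr
  have hr' := hr (by simpa using pow_pos r.2 _)
  simpa using hr'

theorem continuous_complexDirection {d : ℕ} :
    Continuous (complexDirection : EuclideanSpace ℝ (Fin d) → Fin (d + 1) → ℂ) := by
  refine continuous_pi fun a => ?_
  refine Fin.cases ?_ (fun a => ?_) a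
  · simpa [complexDirection] using continuous_const
  · simp only [complexDirection, Fin.cons_succ]
    fun_prop

theorem norm_complexDirection_le {d : ℕ} {θ : EuclideanSpace ℝ (Fin d)} (hθ : ‖θ‖ = 1)
    (a : Fin (d + 1)) : ‖complexDirection θ a‖ ≤ 1 := by
  refine Fin.cases ?_ (fun a => ?_) a
  · simp [complexDirection]
  · simpa [complexDirection, hθ] using PiLp.norm_apply_le θ a

theorem Tensor.continuous_contract {ι : Type} [Fintype ι] {m : ℕ} (t : Tensor ι m) :
    Continuous fun ζ : ι → ℂ => t.contract ζ := by
  unfold Tensor.contract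
  fun_prop

theorem Tensor.continuousAt_contract {ι X : Type} [Fintype ι] [TopologicalSpace X] {m : ℕ}
    {t : X → Tensor ι m} {x : X} (ht : ContinuousAt t x) (ζ : ι → ℂ) :
    ContinuousAt (fun x => (t x).contract ζ) x := by
  have hc : Continuous fun s : Tensor ι m => s.contract ζ := by
    unfold Tensor.contract
    fun_prop
  exact hc.continuousAt.comp_of_eq ht rfl

theorem Tensor.measurable_contract {ι X : Type} [Fintype ι] [MeasurableSpace X] {m : ℕ}
    {t : X → Tensor ι m} {ζ : X → ι → ℂ} (ht : Measurable t) (hζ : Measurable ζ) :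
    Measurable fun x => (t x).contract (ζ x) := by
  unfold Tensor.contract
  refine Finset.measurable_fun_sum _ fun i _ => Measurable.mul ?_ ?_
  · exact (measurable_pi_apply i).comp ht
  · exact Finset.measurable_fun_prod _ fun j _ => (measurable_pi_apply (i j)).comp hζ

theorem Tensor.norm_contract_complexDirection_le {d m : ℕ} (T : Tensor (Fin (d + 1)) m)
    {θ : EuclideanSpace ℝ (Fin d)} (hθ : ‖θ‖ = 1) :
    ‖T.contract (complexDirection θ)‖ ≤ ∑ i, ‖T i‖ := by
  refine (norm_sum_le _ _).trans (Finset.sum_le_sum fun i _ => ?_)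
  rw [norm_mul, norm_prod]
  refine mul_le_of_le_one_right (norm_nonneg _) (Finset.prod_le_one (fun _ _ => norm_nonneg _) ?_)
  exact fun j _ => norm_complexDirection_le hθ _

/-- A set of full spherical measure is dense in the sphere. -/
theorem forall_unit_of_ae_toSphere {E : Type*} [NormedAddCommGroup E] [InnerProductSpace ℝ E]
    [FiniteDimensional ℝ E] [MeasurableSpace E] [BorelSpace E] {P : E → Prop}
    (hP : IsClosed {θ | P θ})
    (h : ∀ᵐ θ : Metric.sphere (0 : E) 1 ∂(volume : Measure E).toSphere, P θ.1)
    {θ : E} (hθ : ‖θ‖ = 1) : P θ := by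
  have hd := Measure.dense_of_ae h
  have hc : IsClosed {θ : Metric.sphere (0 : E) 1 | P θ.1} := hP.preimage continuous_subtype_val
  have hu := hd.closure_eq
  rw [hc.closure_eq] at hu
  have : (⟨θ, by simpa using hθ⟩ : Metric.sphere (0 : E) 1) ∈ (Set.univ : Set _) := Set.mem_univ _
  rw [← hu] at this
  exact this

theorem Tensor.integral_mul_contract {ι X : Type} [Fintype ι] [MeasurableSpace X] {μ : Measure X}
    {m : ℕ} {g : X → Tensor ι m} {e : X → ℂ} (h : ∀ i, Integrable (fun x => e x * g x i) μ)
    (ζ : ι → ℂ) :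
    ∫ x, e x * (g x).contract ζ ∂μ = contract (fun i => ∫ x, e x * g x i ∂μ) ζ := by
  unfold Tensor.contract
  simp only [Finset.mul_sum, ← mul_assoc]
  rw [integral_finsetSum _ fun i _ => (h i).mul_const _]
  exact Finset.sum_congr rfl fun i _ => integral_mul_const _ _

theorem Tensor.integrable_contract {ι X : Type} [Fintype ι] [MeasurableSpace X] {μ : Measure X}
    {m : ℕ} {g : X → Tensor ι m} (h : Integrable g μ) (ζ : ι → ℂ) :
    Integrable (fun x => (g x).contract ζ) μ := by
  unfold Tensor.contract
  exact integrable_finsetSum _ fun i _ => (h.eval i).mul_const _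

/-- The moments are measurable functions of the ray, for a measurable field. -/
theorem measurable_rayMoment {d m : ℕ} {g : EuclideanSpace ℝ (Fin d) → Tensor (Fin (d + 1)) m}
    (hg : Measurable g) (α : ℕ) :
    Measurable fun z : EuclideanSpace ℝ (Fin d) × Metric.sphere (0 : EuclideanSpace ℝ (Fin d)) 1 =>
      rayMoment (fun _ => g) z.1 α z.2.1 := by
  unfold rayMoment
  refine StronglyMeasurable.measurable ?_
  refine StronglyMeasurable.integral_prod_right' (f := fun z : (EuclideanSpace ℝ (Fin d) ×
    Metric.sphere (0 : EuclideanSpace ℝ (Fin d)) 1) × ℝ =>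
    (z.2 : ℂ) ^ α * (g (z.1.1 + z.2 • z.1.2.1)).contract (complexDirection z.1.2.1)) ?_
  refine Measurable.stronglyMeasurable ?_
  refine Measurable.mul (by fun_prop) ?_
  refine Tensor.measurable_contract ?_ ?_
  · exact hg.comp (by fun_prop)
  · exact continuous_complexDirection.measurable.comp (by fun_prop)

/-- The exceptional null set of directions depends on the centre; Fubini exchanges the quantifiers
so that, for fixed θ, one may integrate over centres. Joint measurability of the moments requires g
measurable. -/
theorem ae_toSphere_ae_rayMoment {d m : ℕ}
    {g : EuclideanSpace ℝ (Fin d) → Tensor (Fin (d + 1)) m} (hg : Measurable g)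
    {K : Set (EuclideanSpace ℝ (Fin d))} (hK : MeasurableSet K)
    (h : ∀ x₀ ∉ K, ∀ α ≤ m,
      ∀ᵐ θ : Metric.sphere (0 : EuclideanSpace ℝ (Fin d)) 1
        ∂(volume : Measure (EuclideanSpace ℝ (Fin d))).toSphere,
        rayMoment (fun _ => g) x₀ α θ.1 = 0) :
    ∀ᵐ θ : Metric.sphere (0 : EuclideanSpace ℝ (Fin d)) 1
        ∂(volume : Measure (EuclideanSpace ℝ (Fin d))).toSphere,
      ∀ᵐ x₀ : EuclideanSpace ℝ (Fin d), x₀ ∉ K → ∀ α ≤ m,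
        rayMoment (fun _ => g) x₀ α θ.1 = 0 := by
  refine (Measure.ae_ae_comm (p := fun (x₀ : EuclideanSpace ℝ (Fin d))
    (θ : Metric.sphere (0 : EuclideanSpace ℝ (Fin d)) 1) => x₀ ∉ K → ∀ α ≤ m,
        rayMoment (fun _ => g) x₀ α θ.1 = 0) ?_).1 (Filter.Eventually.of_forall fun x₀ => ?_)
  · have : {z : EuclideanSpace ℝ (Fin d) × Metric.sphere (0 : EuclideanSpace ℝ (Fin d)) 1 |
        z.1 ∉ K → ∀ α ≤ m, rayMoment (fun _ => g) z.1 α z.2.1 = 0} =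
        (Prod.fst ⁻¹' K) ∪ ⋂ α ∈ Set.Iic m, {z | rayMoment (fun _ => g) z.1 α z.2.1 = 0} := by
      ext z
      simp [or_iff_not_imp_left]
    rw [this]
    refine (measurable_fst hK).union (MeasurableSet.biInter (Set.to_countable _) fun α _ => ?_)
    exact measurable_rayMoment hg α (measurableSet_singleton 0)
  · by_cases hx : x₀ ∈ K
    · simp [hx]
    · have := (ae_all_iff (ι := Set.Iic m)).2 fun α => h x₀ hx α.1 α.2
      filter_upwards [this] with θ hθ _ α hα
      exact hθ ⟨α, hα⟩

/-! ### Vanishing of the contracted field -/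

theorem ae_contract_complexDirection_eq_zero_of_measurable {d m : ℕ} (hd : 2 ≤ d)
    {g : EuclideanSpace ℝ (Fin d) → Tensor (Fin (d + 1)) m} (hg : Measurable g)
    (hint : Integrable g) {K : Set (EuclideanSpace ℝ (Fin d))} (hK : IsCompact K)
    (hsupp : ∀ x ∉ K, g x = 0)
    (h : ∀ x₀ ∉ K, ∀ α ≤ m,
      ∀ᵐ θ : Metric.sphere (0 : EuclideanSpace ℝ (Fin d)) 1
        ∂(volume : Measure (EuclideanSpace ℝ (Fin d))).toSphere,
        rayMoment (fun _ => g) x₀ α θ.1 = 0)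
    {θ : EuclideanSpace ℝ (Fin d)} (hθ : ‖θ‖ = 1) :
    ∀ᵐ x, (g x).contract (complexDirection θ) = 0 := by
  obtain ⟨R₀, hR₀⟩ := hK.isBounded.subset_closedBall 0
  set R := max R₀ 0 with hR
  have hKR : ∀ x, R < ‖x‖ → x ∉ K := by
    intro x hx hxK
    have := mem_closedBall_zero_iff.1 (hR₀ hxK)
    exact absurd (this.trans (le_max_left R₀ 0)) (not_le.2 hx)
  set e : EuclideanSpace ℝ (Fin d) → EuclideanSpace ℝ (Fin d) → ℂ :=
    fun ξ x => Complex.exp (-(inner ℝ x ξ : ℝ) * Complex.I) with he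
  have he1 : ∀ ξ x, ‖e ξ x‖ = 1 := by
    intro ξ x
    have := Complex.norm_exp_ofReal_mul_I (-(inner ℝ x ξ))
    simpa [he] using this
  have heg : ∀ ξ i, Integrable fun x => e ξ x * g x i := by
    intro ξ i
    refine (hint.eval i).bdd_mul (c := 1) (Continuous.aestronglyMeasurable (by fun_prop))
      (Filter.Eventually.of_forall fun x => (he1 ξ x).le)
  set T : EuclideanSpace ℝ (Fin d) → Tensor (Fin (d + 1)) m := fun ξ i => ∫ x, e ξ x * g x i with hT
  have hTeq : ∀ ξ ζ, ∫ x, e ξ x * (g x).contract ζ = (T ξ).contract ζ := fun ξ ζ =>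
    Tensor.integral_mul_contract (heg ξ) ζ
  set N : ℝ := ∫ x, ∑ i, ‖g x i‖ with hN
  have hNint : Integrable fun x => ∑ i, ‖g x i‖ := integrable_finsetSum _ fun i _ => (hint.eval i).norm
  have hN0 : 0 ≤ N := integral_nonneg fun x => Finset.sum_nonneg fun i _ => norm_nonneg _
  have hR0 : 0 ≤ R := le_max_right _ _
  -- The constant must not depend on θ, so that the bound passes from a.e. θ to all θ by continuity
  -- and holds on whole great circles.
  set c : EuclideanSpace ℝ (Fin d) → ℝ := fun ξ =>
    (2 * R + 2) ^ (m + 1) * Real.exp (‖ξ‖ * (2 * R + 2)) * N with hc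
  have hbound : ∀ ξ θ : EuclideanSpace ℝ (Fin d), ‖θ‖ = 1 →
      ‖(T ξ).contract (complexDirection θ)‖ ≤ c ξ * |inner ℝ ξ θ| ^ (m + 1) := by
    intro ξ θ hθ
    refine forall_unit_of_ae_toSphere (P := fun θ => ‖(T ξ).contract (complexDirection θ)‖ ≤
      c ξ * |inner ℝ ξ θ| ^ (m + 1)) ?_ ?_ hθ
    · refine isClosed_le ?_ (by fun_prop)
      exact ((T ξ).continuous_contract.comp continuous_complexDirection).norm
    · filter_upwards [ae_toSphere_ae_rayMoment hg hK.measurableSet h] with θ hmom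
      have hθ1 : ‖θ.1‖ = 1 := by simp
      rw [← hTeq]
      refine (norm_integral_exp_mul_le (Tensor.integrable_contract hint _) hR0 ?_ hθ1
        (m := m) ?_ ξ).trans ?_
      · intro x hx
        simp [hsupp x (hKR x hx), Tensor.contract]
      · filter_upwards [hmom] with y hy hyR
        exact hy (hKR y hyR)
      · have h1 : |inner ℝ θ.1 ξ| ≤ ‖ξ‖ := by
          simpa using abs_real_inner_le_norm θ.1 ξ
        have h2 : ∫ x, ‖(g x).contract (complexDirection θ.1)‖ ≤ N :=
          integral_mono (Tensor.integrable_contract hint _).norm hNint fun x =>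
            (g x).norm_contract_complexDirection_le hθ1
        calc _ ≤ (|inner ℝ θ.1 ξ| * (2 * R + 2)) ^ (m + 1) * Real.exp (‖ξ‖ * (2 * R + 2)) * N := by
              gcongr
          _ = _ := by
              rw [real_inner_comm, mul_pow]
              ring
  have hzero : ∀ ξ, (T ξ).contract (complexDirection θ) = 0 := by
    intro ξ
    by_cases hξ : ξ = 0
    · have := hbound ξ θ hθ
      rw [hξ, inner_zero_left, abs_zero, zero_pow (Nat.succ_ne_zero m), mul_zero] at this
      rw [hξ]
      exact norm_le_zero_iff.1 this
    · exact (T ξ).contract_complexDirection_eq_zero hd (by positivity) hξ (hbound ξ) hθ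
  refine ae_eq_zero_of_integral_exp_mul_eq_zero (Tensor.integrable_contract hint _) fun ξ => ?_
  rw [← hzero ξ, ← hTeq]

theorem IsTensorField.ae_contract_complexDirection_eq_zero {d m : ℕ} (hd : 2 ≤ d)
    {K : Set (EuclideanSpace ℝ (Fin d))} (hK : IsCompact K)
    {f : ℝ → EuclideanSpace ℝ (Fin d) → Tensor (Fin (d + 1)) m} (hf : IsTensorField K f)
    (hmom : ∀ x₀ ∉ K, ∀ α ≤ m,
      ∀ᵐ θ : Metric.sphere (0 : EuclideanSpace ℝ (Fin d)) 1
        ∂(volume : Measure (EuclideanSpace ℝ (Fin d))).toSphere,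
        rayMoment f x₀ α θ.1 = 0)
    {θ : EuclideanSpace ℝ (Fin d)} (hθ : ‖θ‖ = 1) :
    ∀ᵐ x, (f 0 x).contract (complexDirection θ) = 0 := by
  obtain ⟨g₀, hg₀m, hg₀⟩ := hf.integrable.aestronglyMeasurable
  -- Cutting off by K makes the representative vanish everywhere outside K, not just almost
  -- everywhere.
  set g := K.indicator g₀ with hg
  have hgm : Measurable g := hg₀m.measurable.indicator hK.measurableSet
  have hfg : ∀ᵐ x, f 0 x = g x := by
    filter_upwards [hg₀] with x hx
    by_cases hxK : x ∈ K
    · rw [hg, Set.indicator_of_mem hxK, hx]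
    · rw [hg, Set.indicator_of_notMem hxK, hf.support 0 x hxK]
  have hmain := ae_contract_complexDirection_eq_zero_of_measurable hd hgm
    (hf.integrable.congr hfg) hK (fun x hx => Set.indicator_of_notMem hx _) ?_ hθ
  · filter_upwards [hmain, hfg] with x hx hx'
    rw [hx', hx]
  · intro x₀ hx₀ α hα
    filter_upwards [hmom x₀ hx₀ α hα, ae_toSphere_ae_ray hfg x₀] with θ h1 h2
    rw [← h1]
    refine integral_congr_ae ?_
    filter_upwards [h2] with r hr
    simp only [hr]

/-! ### The field v and the conclusion -/

theorem eq_zero_of_ae_eq_zero_of_continuousAt {X : Type*} [TopologicalSpace X]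
    [MeasurableSpace X] {μ : Measure X} [μ.IsOpenPosMeasure] {F : X → ℂ} (h : ∀ᵐ x ∂μ, F x = 0)
    {x : X} (hx : ContinuousAt F x) : F x = 0 := by
  have hd : x ∈ closure {x | F x = 0} := Measure.dense_of_ae h x
  have := hx.continuousWithinAt.mem_closure hd (t := {0}) fun y hy => hy
  simpa using this

theorem Tensor.integrable_alternatingSum {d m : ℕ} {X : Type*} [MeasurableSpace X] {μ : Measure X}
    {g : X → Tensor (Fin (d + 1)) m} (hg : Integrable g μ) (p : ℕ) (i : Fin p → Fin d) :
    Integrable (fun x => (g x).alternatingSum p i) μ := by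
  have htilde : ∀ q (i : Fin q → Fin d), Integrable (fun x => (g x).tilde q i) μ :=
    fun q i => (hg.eval _).const_mul _
  have hpow : ∀ q l (i : Fin (q + 2 * l) → Fin d),
      Integrable (fun x => ((g x).tilde q).iDeltaPow l i) μ := by
    intro q l
    induction l with
    | zero => exact htilde q
    | succ l ih =>
      intro i
      exact (integrable_finsetSum _ fun π _ => (ih _).mul_const _).const_mul _
  exact integrable_finsetSum _ fun j _ => (hpow _ _ _).const_mul _

theorem Tensor.iDeltaPow_zero_tensor {ι : Type} [DecidableEq ι] {q : ℕ} (l : ℕ) :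
    (0 : Tensor ι q).iDeltaPow l = 0 := by
  induction l with
  | zero => rfl
  | succ l ih =>
    funext i
    simp [Tensor.iDeltaPow, ih, Tensor.iDelta]

theorem Tensor.alternatingSum_zero_tensor {d m : ℕ} (p : ℕ) :
    (0 : Tensor (Fin (d + 1)) m).alternatingSum p = 0 := by
  have htilde : ∀ q, (0 : Tensor (Fin (d + 1)) m).tilde q = 0 := by
    intro q
    funext i
    simp [Tensor.tilde]
  funext i
  simp [Tensor.alternatingSum, htilde, Tensor.iDeltaPow_zero_tensor]

theorem IsTensorField.assemble {d m : ℕ} {K : Set (EuclideanSpace ℝ (Fin d))}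
    {f : ℝ → EuclideanSpace ℝ (Fin d) → Tensor (Fin (d + 1)) m} (hf : IsTensorField K f) (k : ℕ) :
    IsTensorField K fun x₁ x' => Tensor.assemble (f x₁ x').alternatingSum k where
  symmetric _ _ := Tensor.assemble_isSymmetric _ _
  support x₁ x' hx := by
    funext i
    simp [Tensor.assemble, hf.support x₁ x' hx, Tensor.alternatingSum_zero_tensor]
  integrable := Integrable.of_eval fun i =>
    (Tensor.integrable_alternatingSum hf.integrable _ _).const_mul _

theorem mainTheorem7 (d m : ℕ) (hd : 2 ≤ d)
    (K : Set (EuclideanSpace ℝ (Fin d))) (hK : IsCompact K)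
    (f : ℝ → EuclideanSpace ℝ (Fin d) → Tensor (Fin (d + 1)) m)
    (hf : IsTensorField K f)
    (hmom : ∀ x₀ ∉ K, ∀ α ≤ m,
      ∀ᵐ θ : Metric.sphere (0 : EuclideanSpace ℝ (Fin d)) 1
        ∂(volume : Measure (EuclideanSpace ℝ (Fin d))).toSphere,
        rayMoment f x₀ α θ.1 = 0) :
    (m ≤ 1 →
      (∀ᵐ x' ∂(volume : Measure (EuclideanSpace ℝ (Fin d))), f 0 x' = 0) ∧
      ∀ x', ContinuousAt (f 0) x' → f 0 x' = 0) ∧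
    (∀ (k : ℕ) (hk : m = k + 2),
      ∃ v : ℝ → EuclideanSpace ℝ (Fin d) → Tensor (Fin (d + 1)) k,
        IsTensorField K v ∧
        (∀ᵐ x' ∂(volume : Measure (EuclideanSpace ℝ (Fin d))),
          ∀ i, f 0 x' i = (v 0 x').iDelta (i ∘ Fin.cast hk.symm)) ∧
        (∀ x', ContinuousAt (f 0) x' →
          ∀ i, f 0 x' i = (v 0 x').iDelta (i ∘ Fin.cast hk.symm)) ∧
        ∀ x₁ x', ∀ p ≤ k, ∀ i : Fin p → Fin d,
          v x₁ x' (padIndex k i) = (k.choose (k - p) : ℂ)⁻¹ * (f x₁ x').alternatingSum p i) := by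
  have hd0 : 0 < d := by omega
  have hθ : ∀ θ : EuclideanSpace ℝ (Fin d), ‖θ‖ = 1 →
      ∀ᵐ x, (f 0 x).contract (complexDirection θ) = 0 :=
    fun θ hθ => hf.ae_contract_complexDirection_eq_zero hd hK hmom hθ
  have hae : ∀ᵐ x, ∀ θ : EuclideanSpace ℝ (Fin d), ‖θ‖ = 1 →
      (f 0 x).contract (complexDirection θ) = 0 := by
    -- The null set depends on θ; a countable dense set of directions and continuity in θ give a
    -- single null set.
    obtain ⟨D, hDc, hDd⟩ := TopologicalSpace.exists_countable_dense
      (Metric.sphere (0 : EuclideanSpace ℝ (Fin d)) 1)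
    have hD : ∀ᵐ x, ∀ θ ∈ D, (f 0 x).contract (complexDirection θ.1) = 0 :=
      (ae_ball_iff hDc).2 fun θ _ => hθ θ.1 (by simp)
    filter_upwards [hD] with x hx θ hθ1
    have hc : Continuous fun θ : Metric.sphere (0 : EuclideanSpace ℝ (Fin d)) 1 =>
        (f 0 x).contract (complexDirection θ.1) :=
      (f 0 x).continuous_contract.comp (continuous_complexDirection.comp continuous_subtype_val)
    have hmem : θ ∈ Metric.sphere (0 : EuclideanSpace ℝ (Fin d)) 1 := by simpa using hθ1
    exact congrFun (hc.ext_on hDd continuous_const hx) ⟨θ, hmem⟩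
  have hcont : ∀ x, ContinuousAt (f 0) x → ∀ θ : EuclideanSpace ℝ (Fin d), ‖θ‖ = 1 →
      (f 0 x).contract (complexDirection θ) = 0 := by
    intro x hx θ hθ1
    refine eq_zero_of_ae_eq_zero_of_continuousAt (hθ θ hθ1) ?_
    exact Tensor.continuousAt_contract hx _
  refine ⟨fun hm => ⟨?_, ?_⟩, fun k hk => ⟨_, hf.assemble k, ?_, ?_, ?_⟩⟩
  · filter_upwards [hae] with x hx
    exact (hf.symmetric 0 x).eq_zero_of_le_one hd0 hx hm
  · exact fun x hx => (hf.symmetric 0 x).eq_zero_of_le_one hd0 (hcont x hx) hm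
  · filter_upwards [hae] with x hx i
    exact (hf.symmetric 0 x).eq_iDelta_assemble hd0 hx hk i
  · exact fun x hx i => (hf.symmetric 0 x).eq_iDelta_assemble hd0 (hcont x hx) hk i
  · exact fun x₁ x p hp i =>
      Tensor.assemble_padIndex (hf.symmetric x₁ x).alternatingSum hp i
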